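/- Let $M$ be an $n$-dimensional smooth manifold with $n\neq 1$, let $\mathcal{E}\to M$ be a smooth real vector bundle of rank $n$, let $\phi:TM\to\mathcal{E}$ be a smooth bundle map over $M$ (fibrewise linear, of possibly varying rank), and let $\nabla^{\mathcal{E}}$ be a smooth connection on $\mathcal{E}$ with curvature $R^{\nabla^{\mathcal{E}}}(X,Y)\eta=\nabla^{\mathcal{E}}_X\nabla^{\mathcal{E}}_Y\eta-\nabla^{\mathcal{E}}_Y\nabla^{\mathcal{E}}_X\eta-\nabla^{\mathcal{E}}_{[X,Y]}\eta$. Assume that $(\mathcal{E},\phi,\nabla^{\mathcal{E}})$ is a coherent tangent bundle, i.e. that $\nabla^{\mathcal{E}}$ is relatively torsion-free with respect to $\phi$: $$\nabla^{\mathcal{E}}_X\phi(Y)-\nabla^{\mathcal{E}}_Y\phi(X)-\phi([X,Y])=0\qquad\text{for all } X,Y\in\Gamma(TM),$$ and assume that $\operatorname{tr}\{\eta\mapsto R^{\nabla^{\mathcal{E}}}(X,Y)\eta\}=0$ for all $X,Y\in\Gamma(TM)$. Call $\nabla^{\mathcal{E}}$ projectively flat if every point of $M$ has an open neighbourhood $U$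 for which there are a flat connection $\widehat\nabla^{\mathcal{E}}$ on $\mathcal{E}|_U$ that is relatively torsion-free with respect to $\phi|_U$, and a smooth section $\rho\in\Gamma(\mathcal{E}^*|_U)$, such that $$\widehat\nabla^{\mathcal{E}}_X\eta=\nabla^{\mathcal{E}}_X\eta+\rho(\phi(X))\,\eta+\rho(\eta)\,\phi(X)\qquad\text{for all } X\in\Gamma(TU),\ \eta\in\Gamma(\mathcal{E}|_U).$$ Then the following two conditions are equivalent: (i) $\nabla^{\mathcal{E}}$ is projectively flat. (ii) For every $p\in M$ there exist an open neighbourhood $U$ of $p$ and a smooth tensor field $A\in\Gamma(T^*U\otimes\mathcal{E}^*|_U)$ such that $$R^{\nabla^{\mathcal{E}}}(X,Y)\eta=\frac{1}{n-1}\{A(Y,\eta)\phi(X)-A(X,\eta)\phi(Y)\}$$ and $$X A(Y,\eta)-Y A(X,\eta)-A([X,Y],\eta)=A(Y,\nabla^{\mathcal{E}}_X\eta)-A(X,\nabla^{\mathcal{E}}_Y\eta)$$ for all $X,Y\in\Gamma(TU)$ and $\eta\in\Gamma(\mathcal{E}|_U)$. -/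

import Mathlib

open Bundle VectorField
open scoped Manifold ContDiff Topology Bundle

/-! Conventions. A vector bundle with model fibre `F` over `M` is a family of fibres `V x`. A section
over an open set `U` is represented by a function on all of `M` whose values outside `U` are
irrelevant: everything below evaluates at points of `U` and depends on germs only.
As in Mathlib, `cov σ x (X x)` is the covariant derivative `∇_X σ` at `x`. -/

namespace CoherentTangent

section Defs

variable {E : Type*} [NormedAddCommGroup E] [NormedSpace ℝ E]
  {H : Type*} [TopologicalSpace H] (I : ModelWithCorners ℝ E H)
  {M : Type*} [TopologicalSpace M] [ChartedSpace H M] [IsManifold I 1 M]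
  (F : Type*) [NormedAddCommGroup F] [NormedSpace ℝ F]
  {V : M → Type*} [TopologicalSpace (TotalSpace F V)] [∀ x, TopologicalSpace (V x)]

/-- The section `σ` of the bundle `V` is smooth on `U`. -/
def SmoothOn [FiberBundle F V] (U : Set M) (σ : Π x, V x) : Prop :=
  ContMDiffOn I (I.prod 𝓘(ℝ, F)) ∞ (fun x ↦ TotalSpace.mk' F x (σ x)) U

variable [∀ x, AddCommGroup (V x)] [∀ x, Module ℝ (V x)]
  [∀ x, IsTopologicalAddGroup (V x)] [∀ x, ContinuousSMul ℝ (V x)]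
  [FiberBundle F V] [VectorBundle ℝ F V]

/-- `φ : TM → V` is a smooth bundle map over `U`, i.e. a smooth section of `Hom(TM, V)`. -/
def SmoothBundleMapOn (U : Set M) (φ : Π x : M, TangentSpace I x →L[ℝ] V x) :
    Prop :=
  SmoothOn I (E →L[ℝ] F) (V := fun x : M ↦ TangentSpace I x →L[ℝ] V x) U φ

/-- `ρ` is a smooth section over `U` of the dual bundle `V*`. -/
def SmoothDualSectionOn (U : Set M) (ρ : Π x : M, V x →L[ℝ] ℝ) : Prop :=
  SmoothOn I (F →L[ℝ] ℝ) (V := fun x : M ↦ V x →L[ℝ] ℝ) U ρ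

/-- `A` is a smooth section over `U` of `T*M ⊗ V*`. -/
def SmoothTensorOn (U : Set M)
    (A : Π x : M, TangentSpace I x →L[ℝ] V x →L[ℝ] ℝ) : Prop :=
  SmoothOn I (E →L[ℝ] F →L[ℝ] ℝ) (V := fun x : M ↦ TangentSpace I x →L[ℝ] V x →L[ℝ] ℝ) U A

/-- `cov` is a (smooth, linear) connection on the restriction of `V` to `U`: additivity and the
Leibniz rule, and `∇σ` is smooth wherever `σ` is. -/
structure IsConnectionOn (U : Set M)
    (cov : (Π x : M, V x) → (Π x : M, TangentSpace I x →L[ℝ] V x)) : Prop where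
  covariant : IsCovariantDerivativeOn F cov U
  smooth : ∀ W : Set M, IsOpen W → W ⊆ U → ∀ σ : Π x : M, V x, SmoothOn I F W σ →
    SmoothBundleMapOn I F W (cov σ)

/-- The curvature `R(X, Y)σ = ∇_X ∇_Y σ - ∇_Y ∇_X σ - ∇_{[X, Y]} σ`. -/
noncomputable def curvature (cov : (Π x : M, V x) → (Π x : M, TangentSpace I x →L[ℝ] V x))
    (X Y : Π x : M, TangentSpace I x) (σ : Π x : M, V x) (x : M) : V x :=
  cov (fun y ↦ cov σ y (Y y)) x (X x) - cov (fun y ↦ cov σ y (X y)) x (Y x)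
    - cov σ x (mlieBracket I X Y x)

/-- The connection `cov` has vanishing curvature over `U`. -/
def IsFlatOn (U : Set M) (cov : (Π x : M, V x) → (Π x : M, TangentSpace I x →L[ℝ] V x)) : Prop :=
  ∀ (X Y : Π x : M, TangentSpace I x) (σ : Π x : M, V x),
    SmoothOn I E U X → SmoothOn I E U Y → SmoothOn I F U σ →
    ∀ x ∈ U, curvature I cov X Y σ x = 0

/-- `cov` is relatively torsion-free with respect to `φ` over `U`. -/
def IsRelativelyTorsionFreeOn (U : Set M) (φ : Π x : M, TangentSpace I x →L[ℝ] V x)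
    (cov : (Π x : M, V x) → (Π x : M, TangentSpace I x →L[ℝ] V x)) : Prop :=
  ∀ X Y : Π x : M, TangentSpace I x, SmoothOn I E U X → SmoothOn I E U Y → ∀ x ∈ U,
    cov (fun y ↦ φ y (Y y)) x (X x) - cov (fun y ↦ φ y (X y)) x (Y x)
      - φ x (mlieBracket I X Y x) = 0

/-- `(V, φ, cov)` is a coherent tangent bundle over `M` (apart from the equality of the rank of `V`
and the dimension of `M`, which is a condition on the bundle alone). -/
structure IsCoherentTangentBundle (φ : Π x : M, TangentSpace I x →L[ℝ] V x)
    (cov : (Π x : M, V x) → (Π x : M, TangentSpace I x →L[ℝ] V x)) : Prop where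
  smooth_map : SmoothBundleMapOn I F Set.univ φ
  connection : IsConnectionOn I F Set.univ cov
  torsionFree : IsRelativelyTorsionFreeOn I Set.univ φ cov

/-- The connections `cov` and `cov'` are projectively equivalent with respect to `φ` over `U`. -/
def ProjectivelyEquivalentOn (U : Set M) (φ : Π x : M, TangentSpace I x →L[ℝ] V x)
    (cov cov' : (Π x : M, V x) → (Π x : M, TangentSpace I x →L[ℝ] V x)) : Prop :=
  ∃ ρ : Π x : M, V x →L[ℝ] ℝ, SmoothDualSectionOn I F U ρ ∧
    ∀ (X : Π x : M, TangentSpace I x) (η : Π x : M, V x),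
      SmoothOn I E U X → SmoothOn I F U η → ∀ x ∈ U,
        cov' η x (X x) = cov η x (X x) + ρ x (φ x (X x)) • η x + ρ x (η x) • φ x (X x)

/-- `cov` is projectively flat with respect to `φ`: near every point it is projectively equivalent
to a flat connection that is relatively torsion-free with respect to `φ`. -/
def IsProjectivelyFlat (φ : Π x : M, TangentSpace I x →L[ℝ] V x)
    (cov : (Π x : M, V x) → (Π x : M, TangentSpace I x →L[ℝ] V x)) : Prop :=
  ∀ p : M, ∃ U : Set M, IsOpen U ∧ p ∈ U ∧
    ∃ cov' : (Π x : M, V x) → (Π x : M, TangentSpace I x →L[ℝ] V x),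
      IsConnectionOn I F U cov' ∧ IsRelativelyTorsionFreeOn I U φ cov' ∧ IsFlatOn I F U cov' ∧
      ProjectivelyEquivalentOn I F U φ cov cov'

/-- `R(X, Y)η = (1 / (n - 1)) {A(Y, η) φ(X) - A(X, η) φ(Y)}` over `U`. -/
def CurvatureFormulaOn (n : ℕ) (U : Set M) (φ : Π x : M, TangentSpace I x →L[ℝ] V x)
    (cov : (Π x : M, V x) → (Π x : M, TangentSpace I x →L[ℝ] V x))
    (A : Π x : M, TangentSpace I x →L[ℝ] V x →L[ℝ] ℝ) : Prop :=
  ∀ (X Y : Π x : M, TangentSpace I x) (η : Π x : M, V x),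
    SmoothOn I E U X → SmoothOn I E U Y → SmoothOn I F U η → ∀ x ∈ U,
      curvature I cov X Y η x =
        (1 / ((n : ℝ) - 1)) • (A x (Y x) (η x) • φ x (X x) - A x (X x) (η x) • φ x (Y x))

/-- `X A(Y, η) - Y A(X, η) - A([X, Y], η) = A(Y, ∇_X η) - A(X, ∇_Y η)` over `U`. -/
def CodazziOn (U : Set M)
    (cov : (Π x : M, V x) → (Π x : M, TangentSpace I x →L[ℝ] V x))
    (A : Π x : M, TangentSpace I x →L[ℝ] V x →L[ℝ] ℝ) : Prop :=
  ∀ (X Y : Π x : M, TangentSpace I x) (η : Π x : M, V x),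
    SmoothOn I E U X → SmoothOn I E U Y → SmoothOn I F U η → ∀ x ∈ U,
      mvfderiv I (fun y ↦ A y (Y y) (η y)) x (X x) - mvfderiv I (fun y ↦ A y (X y) (η y)) x (Y x)
        - A x (mlieBracket I X Y x) (η x) =
      A x (Y x) (cov η x (X x)) - A x (X x) (cov η x (Y x))

end Defs

/-! ### The trace of the curvature -/

section Trace

set_option linter.unusedSectionVars false

variable {E : Type*} [NormedAddCommGroup E] [NormedSpace ℝ E]
  {H : Type*} [TopologicalSpace H] {I : ModelWithCorners ℝ E H}
  {M : Type*} [TopologicalSpace M] [ChartedSpace H M] [IsManifold I 1 M]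
  {F : Type*} [NormedAddCommGroup F] [NormedSpace ℝ F]
  {V : M → Type*} [TopologicalSpace (TotalSpace F V)] [∀ x, TopologicalSpace (V x)]
  [∀ x, AddCommGroup (V x)] [∀ x, Module ℝ (V x)]
  [∀ x, IsTopologicalAddGroup (V x)] [∀ x, ContinuousSMul ℝ (V x)]
  [FiberBundle F V] [VectorBundle ℝ F V]
  {cov : (Π x : M, V x) → (Π x : M, TangentSpace I x →L[ℝ] V x)}
  {X Y : Π x : M, TangentSpace I x}

theorem IsConnectionOn.mono {U W : Set M} (h : IsConnectionOn I F U cov) (hWU : W ⊆ U) :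
    IsConnectionOn I F W cov :=
  ⟨h.covariant.mono hWU, fun W' hW' hs ↦ h.smooth W' hW' (hs.trans hWU)⟩

theorem SmoothOn.mdifferentiableAt {W : Set M} (hW : IsOpen W) {σ : Π x : M, V x}
    (hσ : SmoothOn I F W σ) {x : M} (hx : x ∈ W) :
    MDifferentiableAt I (I.prod 𝓘(ℝ, F)) (fun y ↦ TotalSpace.mk' F y (σ y)) x :=
  ((hσ x hx).contMDiffAt (hW.mem_nhds hx)).mdifferentiableAt (by simp)

theorem IsConnectionOn.smoothOn_apply {U W : Set M} (h : IsConnectionOn I F U cov)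
    (hW : IsOpen W) (hWU : W ⊆ U) {σ : Π x : M, V x} (hσ : SmoothOn I F W σ)
    (hX : SmoothOn I E W X) : SmoothOn I F W (fun y ↦ cov σ y (X y)) :=
  ContMDiffOn.clm_bundle_apply (h.smooth W hW hWU σ hσ) hX

theorem curvature_congr {W : Set M} (hW : IsOpen W) (h : IsConnectionOn I F W cov)
    (hX : SmoothOn I E W X) (hY : SmoothOn I E W Y) {σ τ : Π x : M, V x}
    (hσ : SmoothOn I F W σ) (hτ : SmoothOn I F W τ) (hστ : ∀ y ∈ W, σ y = τ y)
    {x : M} (hx : x ∈ W) :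
    curvature I cov X Y σ x = curvature I cov X Y τ x := by
  have e : ∀ y ∈ W, cov σ y = cov τ y := fun y hy ↦
    h.covariant.congr_of_eqOn (hσ.mdifferentiableAt hW hy) (hτ.mdifferentiableAt hW hy)
      (hW.mem_nhds hy) hστ
  have key : ∀ Z : Π x : M, TangentSpace I x, SmoothOn I E W Z →
      cov (fun y ↦ cov σ y (Z y)) x = cov (fun y ↦ cov τ y (Z y)) x := fun Z hZ ↦
    h.covariant.congr_of_eqOn
      ((h.smoothOn_apply hW subset_rfl hσ hZ).mdifferentiableAt hW hx)
      ((h.smoothOn_apply hW subset_rfl hτ hZ).mdifferentiableAt hW hx)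
      (hW.mem_nhds hx) fun y hy ↦ by rw [e y hy]
  simp only [curvature, key X hX, key Y hY, e x hx]

theorem curvature_add {W : Set M} (hW : IsOpen W) (h : IsConnectionOn I F W cov)
    (hX : SmoothOn I E W X) (hY : SmoothOn I E W Y) {σ τ : Π x : M, V x}
    (hσ : SmoothOn I F W σ) (hτ : SmoothOn I F W τ) {x : M} (hx : x ∈ W) :
    curvature I cov X Y (σ + τ) x = curvature I cov X Y σ x + curvature I cov X Y τ x := by
  have key : ∀ Z : Π x : M, TangentSpace I x, SmoothOn I E W Z →
      cov (fun y ↦ cov (σ + τ) y (Z y)) x =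
        cov (fun y ↦ cov σ y (Z y)) x + cov (fun y ↦ cov τ y (Z y)) x := by
    intro Z hZ
    have h1 := (h.smoothOn_apply hW subset_rfl hσ hZ).mdifferentiableAt hW hx
    have h2 := (h.smoothOn_apply hW subset_rfl hτ hZ).mdifferentiableAt hW hx
    have h3 := (h.smoothOn_apply hW subset_rfl
      (show SmoothOn I F W (σ + τ) from ContMDiffOn.add_section hσ hτ) hZ).mdifferentiableAt hW hx
    rw [← h.covariant.add h1 h2 hx]
    refine h.covariant.congr_of_eqOn h3 (mdifferentiableAt_add_section h1 h2)
      (hW.mem_nhds hx) fun y hy ↦ ?_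
    rw [h.covariant.add (hσ.mdifferentiableAt hW hy) (hτ.mdifferentiableAt hW hy) hy]
    rfl
  simp only [curvature, key X hX, key Y hY,
    h.covariant.add (hσ.mdifferentiableAt hW hx) (hτ.mdifferentiableAt hW hx) hx,
    add_apply]
  abel

theorem curvature_smul {W : Set M} (hW : IsOpen W) (h : IsConnectionOn I F W cov)
    (hX : SmoothOn I E W X) (hY : SmoothOn I E W Y) (c : ℝ) {σ : Π x : M, V x}
    (hσ : SmoothOn I F W σ) {x : M} (hx : x ∈ W) :
    curvature I cov X Y (c • σ) x = c • curvature I cov X Y σ x := by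
  have key : ∀ Z : Π x : M, TangentSpace I x, SmoothOn I E W Z →
      cov (fun y ↦ cov (c • σ) y (Z y)) x = c • cov (fun y ↦ cov σ y (Z y)) x := by
    intro Z hZ
    have h1 := (h.smoothOn_apply hW subset_rfl hσ hZ).mdifferentiableAt hW hx
    have h3 := (h.smoothOn_apply hW subset_rfl
      (show SmoothOn I F W (c • σ) from ContMDiffOn.const_smul_section hσ) hZ).mdifferentiableAt hW hx
    rw [← h.covariant.smul_const c h1 hx]
    refine h.covariant.congr_of_eqOn h3 (h1.smul_const_section)
      (hW.mem_nhds hx) fun y hy ↦ ?_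
    rw [h.covariant.smul_const c (hσ.mdifferentiableAt hW hy) hy]
    rfl
  simp only [curvature, key X hX, key Y hY,
    h.covariant.smul_const c (hσ.mdifferentiableAt hW hx) hx, smul_apply]
  module

variable [ContMDiffVectorBundle ∞ F V I]

theorem smoothOn_extend {x : M} (w : V x) :
    SmoothOn I F (trivializationAt F V x).baseSet (FiberBundle.extend F w) := by
  intro y hy
  rw [(trivializationAt F V x).contMDiffWithinAt_section _ hy]
  exact (contMDiffOn_const (c := ((trivializationAt F V x) ⟨x, w⟩).2)).congr
    (fun z hz ↦ by simp [FiberBundle.extend, hz]) y hy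

theorem extend_add {x y : M} (hy : y ∈ (trivializationAt F V x).baseSet) (v w : V x) :
    FiberBundle.extend F (v + w) y = FiberBundle.extend F v y + FiberBundle.extend F w y := by
  have hx := FiberBundle.mem_baseSet_trivializationAt' (F := F) (E := V) x
  simp only [FiberBundle.extend, ← (trivializationAt F V x).symmL_apply (R := ℝ) hy,
    ((trivializationAt F V x).linear ℝ hx).map_add, map_add]

theorem extend_smul {x y : M} (hy : y ∈ (trivializationAt F V x).baseSet) (c : ℝ) (v : V x) :
    FiberBundle.extend F (c • v) y = c • FiberBundle.extend F v y := by
  have hx := FiberBundle.mem_baseSet_trivializationAt' (F := F) (E := V) x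
  simp only [FiberBundle.extend, ← (trivializationAt F V x).symmL_apply (R := ℝ) hy,
    ((trivializationAt F V x).linear ℝ hx).map_smul, map_smul]

/-- The curvature endomorphism `R(X, Y)` of the fibre `V x`: a vector `w` is extended to a smooth
local section, on which the curvature is evaluated at `x` (the curvature is tensorial, so the
extension does not matter). -/
noncomputable def curvatureEnd (h : IsConnectionOn I F Set.univ cov)
    (hX : SmoothOn I E Set.univ X) (hY : SmoothOn I E Set.univ Y) (x : M) : V x →ₗ[ℝ] V x where
  toFun w := curvature I cov X Y (FiberBundle.extend F w) x
  map_add' v w := by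
    have ho := (trivializationAt F V x).open_baseSet
    have hx := FiberBundle.mem_baseSet_trivializationAt' (F := F) (E := V) x
    have h' := h.mono (Set.subset_univ (trivializationAt F V x).baseSet)
    have hX' : SmoothOn I E (trivializationAt F V x).baseSet X :=
      ContMDiffOn.mono hX (Set.subset_univ _)
    have hY' : SmoothOn I E (trivializationAt F V x).baseSet Y :=
      ContMDiffOn.mono hY (Set.subset_univ _)
    rw [← curvature_add ho h' hX' hY' (smoothOn_extend v) (smoothOn_extend w) hx]
    exact curvature_congr ho h' hX' hY' (smoothOn_extend _)
      (ContMDiffOn.add_section (smoothOn_extend v) (smoothOn_extend w))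
      (fun y hy ↦ extend_add hy v w) hx
  map_smul' c w := by
    have ho := (trivializationAt F V x).open_baseSet
    have hx := FiberBundle.mem_baseSet_trivializationAt' (F := F) (E := V) x
    have h' := h.mono (Set.subset_univ (trivializationAt F V x).baseSet)
    have hX' : SmoothOn I E (trivializationAt F V x).baseSet X :=
      ContMDiffOn.mono hX (Set.subset_univ _)
    have hY' : SmoothOn I E (trivializationAt F V x).baseSet Y :=
      ContMDiffOn.mono hY (Set.subset_univ _)
    rw [RingHom.id_apply, ← curvature_smul ho h' hX' hY' c (smoothOn_extend w) hx]
    exact curvature_congr ho h' hX' hY' (smoothOn_extend _)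
      (ContMDiffOn.const_smul_section (smoothOn_extend w))
      (fun y hy ↦ extend_smul hy c w) hx

/-- `tr {η ↦ R(X, Y)η} = 0` for all vector fields `X`, `Y`. -/
def IsTraceFree (h : IsConnectionOn I F Set.univ cov) : Prop :=
  ∀ (X Y : Π x : M, TangentSpace I x)
    (hX : SmoothOn I E Set.univ X) (hY : SmoothOn I E Set.univ Y) (x : M),
    LinearMap.trace ℝ (V x) (curvatureEnd h hX hY x) = 0

end Trace

end CoherentTangent

/-! A dual section `ρ` determines the tensor `B(X, η) = (∇_X ρ)(η) - ρ(φX) ρ(η)`. For relatively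
torsion-free `∇`, the projective change by `ρ` has curvature `R(X, Y)η + (B(X, φY) - B(Y, φX))η +
B(X, η)φY - B(Y, η)φX` (`IsSchoutenOn.curvature_projectiveChange`). Everything rests on this
formula.

If the changed connection is flat, the trace of the formula gives `(rank + 1)(B(Y, φX) - B(X, φY)) =
0`, so `B(·, φ·)` is symmetric and `R(X, Y)η = B(Y, η)φX - B(X, η)φY`. Antisymmetrizing the
derivative of `B` produces `ρ(R(X, Y)η)`, which the quadratic terms cancel; this is the Codazzi
equation (`IsSchoutenOn.codazziOn`). The required tensor is `A = (n - 1)B`.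

Conversely, put `C = A / (n - 1)`. Trace-freeness makes `C(·, φ·)` symmetric, and flatness of the
changed connection follows once `∇ρ = C + (ρ ∘ φ) ⊗ ρ` is solved. The substitution `ρ = -μ / f`
linearizes this Riccati-type equation to `∇μ = -f C`, `df = μ ∘ φ`. The integrability conditions of
the linear system are exactly the curvature formula, the Codazzi equation, the torsion equation and
the symmetry of `C` (`systemEnd_eq_commutator`, `IsConnectionFormOn.systemEnd_flat`). The initial
value `(μ, f) = (0, 1)` keeps `f` nonzero near the point (`exists_isSchoutenOn_of_codazziOn`).

The linear system is solved by a Frobenius theorem (`exists_hasFDerivAt_of_flat`): it is integrated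
along rays, and a Grönwall estimate using flatness shows directly that the result is differentiable
with the prescribed derivative, so no smooth dependence of ODE solutions on parameters enters. -/

namespace CoherentTangent

/-! ### Flat linear total differential equations in a normed space. -/

section Frobenius

variable {E : Type*} [NormedAddCommGroup E] [NormedSpace ℝ E]
  {L : Type*} [NormedRing L] [NormedAlgebra ℝ L]

/-- A linear differential equation `y' = A(t) y` on `[0, 1]` whose coefficient is bounded by `1/2`
has a solution with any initial value. -/
theorem exists_linear_ode_solution [CompleteSpace L] {A : ℝ → L}
    (hA : ContinuousOn A (Set.Icc 0 1)) (hb : ∀ t ∈ Set.Icc (0 : ℝ) 1, ‖A t‖ ≤ 1 / 2) (u₀ : L) :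
    ∃ y : ℝ → L, y 0 = u₀ ∧
      ∀ t ∈ Set.Icc (0 : ℝ) 1, HasDerivWithinAt y (A t * y t) (Set.Icc 0 1) t := by
  have h0 : (0 : ℝ) ∈ Set.Icc (0 : ℝ) 1 := by simp
  -- On the ball of radius `‖u₀‖` about `u₀` one has `‖y‖ ≤ 2‖u₀‖`, so the bound `1/2` limits the
  -- speed to `‖u₀‖`, and in unit time the solution cannot leave the ball.
  have hpl : IsPicardLindelof (fun t y ↦ A t * y) (⟨0, h0⟩ : Set.Icc (0 : ℝ) 1) u₀
      ‖u₀‖₊ 0 ‖u₀‖₊ 1 := by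
    refine ⟨fun t ht ↦ ?_, fun x _ ↦ hA.mul continuousOn_const, fun t ht x hx ↦ ?_, ?_⟩
    · refine LipschitzOnWith.of_dist_le_mul fun x _ y _ ↦ ?_
      rw [dist_eq_norm, dist_eq_norm, ← mul_sub]
      refine (norm_mul_le _ _).trans ?_
      simp only [NNReal.coe_one]
      nlinarith [norm_nonneg (x - y), hb t ht]
    · have h1 : ‖x‖ ≤ ‖u₀‖ + ‖u₀‖ := by
        have := mem_closedBall_iff_norm.1 hx
        have h2 := norm_le_norm_add_norm_sub' x u₀
        simp only [coe_nnnorm] at this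
        linarith
      refine (norm_mul_le _ _).trans ?_
      simp only [coe_nnnorm]
      nlinarith [hb t ht, norm_nonneg x]
    · simp
  obtain ⟨y, hy0, hy⟩ := hpl.exists_eq_forall_mem_Icc_hasDerivWithinAt₀
  exact ⟨y, hy0, hy⟩

theorem hasDerivWithinAt_Ici_of_Icc {f : ℝ → L} {f' : L} {a b t : ℝ}
    (h : HasDerivWithinAt f f' (Set.Icc a b) t) (ht : t ∈ Set.Ico a b) :
    HasDerivWithinAt f f' (Set.Ici t) t :=
  h.mono_of_mem_nhdsWithin (Icc_mem_nhdsGE_of_mem ht)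

/-- Radial solutions of a flat linear system satisfy the system up to an error of second order. -/
theorem radial_solution_error {θ : E → E →L[ℝ] L} {θ' : E → E →L[ℝ] E →L[ℝ] L}
    {r C K : ℝ} (hr1 : r ≤ 1) (hC : 1 ≤ C) (hCr : C * r ≤ 1 / 2)
    (hθ' : ∀ x ∈ Metric.ball (0 : E) r, HasFDerivAt θ (θ' x) x)
    (hb : ∀ x ∈ Metric.ball (0 : E) r, ‖θ x‖ ≤ C)
    (hb' : ∀ x ∈ Metric.ball (0 : E) r, ‖θ' x‖ ≤ C)
    (hlip : ∀ x ∈ Metric.ball (0 : E) r, ∀ y ∈ Metric.ball (0 : E) r, ‖θ y - θ x‖ ≤ C * ‖y - x‖)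
    (htaylor : ∀ x ∈ Metric.ball (0 : E) r, ∀ y ∈ Metric.ball (0 : E) r,
      ‖θ y - θ x - θ' x (y - x)‖ ≤ C * ‖y - x‖ ^ 2)
    (hflat : ∀ x ∈ Metric.ball (0 : E) r, ∀ v w : E,
      θ' x v w - θ' x w v = θ x v * θ x w - θ x w * θ x v)
    {x z : E} (hx : x ∈ Metric.ball (0 : E) r) (hz : z ∈ Metric.ball (0 : E) r)
    {f g : ℝ → L} (hfg : f 0 = g 0)
    (hf : ∀ t ∈ Set.Icc (0 : ℝ) 1, HasDerivWithinAt f (θ (t • x) x * f t) (Set.Icc 0 1) t)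
    (hg : ∀ t ∈ Set.Icc (0 : ℝ) 1, HasDerivWithinAt g (θ (t • z) z * g t) (Set.Icc 0 1) t)
    (hgK : ∀ t ∈ Set.Icc (0 : ℝ) 1, ‖g t‖ ≤ K) :
    ‖g 1 - f 1 - θ x (z - x) * g 1‖ ≤ 20 * C ^ 2 * K * ‖z - x‖ ^ 2 := by
  have hC0 : 0 ≤ C := by linarith
  have hK : 0 ≤ K := (norm_nonneg _).trans (hgK 0 (by simp))
  set h := z - x with hh
  have hxr : ‖x‖ < r := by simpa using hx
  have hzr : ‖z‖ < r := by simpa using hz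
  have hmem : ∀ t ∈ Set.Icc (0 : ℝ) 1, ∀ y : E, ‖y‖ < r → t • y ∈ Metric.ball (0 : E) r := by
    intro t ht y hy
    rw [mem_ball_zero_iff, norm_smul, Real.norm_of_nonneg ht.1]
    nlinarith [ht.2, ht.1, norm_nonneg y]
  -- `t θ(tx)h g(t)` is the expected first variation of the radial solution when the ray moves from
  -- `x` to `x + h`; `w` is the deviation from it, zero at `t = 0` and equal to the quantity to be
  -- bounded at `t = 1`.
  set w : ℝ → L := fun t ↦ g t - f t - t • (θ (t • x) h * g t) with hw
  set w' : ℝ → L := fun t ↦ θ (t • z) z * g t - θ (t • x) x * f t -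
    (t • (θ' (t • x) x h * g t + θ (t • x) h * (θ (t • z) z * g t)) + θ (t • x) h * g t) with hw'
  have hwd : ∀ t ∈ Set.Icc (0 : ℝ) 1, HasDerivWithinAt w (w' t) (Set.Icc 0 1) t := by
    intro t ht
    have h1 : HasDerivAt (fun s : ℝ ↦ θ (s • x)) (θ' (t • x) x) t := by
      have h2 : HasDerivAt (fun s : ℝ ↦ s • x) x t := by
        simpa using (hasDerivAt_id t).smul_const x
      exact (hθ' _ (hmem t ht x hxr)).comp_hasDerivAt t h2
    have h3 : HasDerivAt (fun s : ℝ ↦ θ (s • x) h) (θ' (t • x) x h) t := by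
      simpa using h1.clm_apply (hasDerivAt_const t h)
    have h4 := (h3.hasDerivWithinAt (s := Set.Icc 0 1)).fun_mul (hg t ht)
    have h5 := (hasDerivWithinAt_id t (Set.Icc 0 1)).smul h4
    have h6 := ((hg t ht).sub (hf t ht)).sub h5
    simpa [hw, hw'] using! h6
  have hw0 : w 0 = 0 := by simp [hw, hfg]
  -- The factor `1/2` is the bound `C r` for `θ(tx)x`; the remainders contribute at most `C + C +
  -- 2C² ≤ 4C²`, and `10` leaves slack.
  have key : ∀ t ∈ Set.Ico (0 : ℝ) 1, ‖w' t‖ ≤ 1 / 2 * ‖w t‖ + 10 * C ^ 2 * K * ‖h‖ ^ 2 := by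
    intro t ht'
    have ht : t ∈ Set.Icc (0 : ℝ) 1 := ⟨ht'.1, ht'.2.le⟩
    have mx := hmem t ht x hxr
    have mz := hmem t ht z hzr
    -- Flatness is used only here: it exchanges the derivative of `θ` along the ray for the one in
    -- direction `h`, up to a commutator. All terms of first order in `h` in `w'` are then absorbed
    -- in `θ(tx)x w`.
    have fl : θ' (t • x) x h = θ' (t • x) h x + θ (t • x) x * θ (t • x) h
        - θ (t • x) h * θ (t • x) x := by
      rw [add_sub_assoc, ← hflat _ mx x h]; abel
    have htz : t • z - t • x = t • h := by rw [hh, smul_sub]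
    have ez : z = x + h := by rw [hh]; abel
    have e : w' t = θ (t • x) x * w t
        + (θ (t • z) z - θ (t • x) z - θ' (t • x) (t • h) z) * g t
        + t • (θ' (t • x) h h * g t)
        - t • (θ (t • x) h * ((θ (t • z) z - θ (t • x) z + θ (t • x) h) * g t)) := by
      have e1 : θ (t • x) z = θ (t • x) x + θ (t • x) h := by rw [ez, map_add]
      have e2 : θ' (t • x) h z = θ' (t • x) h x + θ' (t • x) h h := by rw [ez, map_add]
      simp only [hw, hw', fl, map_smul, smul_apply, e1, e2]
      simp only [mul_sub, sub_mul, mul_add, add_mul, smul_add, smul_sub, mul_smul_comm,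
        smul_mul_assoc, mul_assoc]
      abel
    have nt : ‖t‖ ≤ 1 := by rw [Real.norm_of_nonneg ht.1]; exact ht.2
    have nth : ‖t • h‖ ≤ ‖h‖ := by
      rw [norm_smul]; nlinarith [norm_nonneg h]
    have nz1 : ‖z‖ ≤ 1 := by linarith
    have nh := norm_nonneg h
    have ng := hgK t ht
    have b0 : ‖θ (t • x) x * w t‖ ≤ 1 / 2 * ‖w t‖ := by
      refine (norm_mul_le _ _).trans ?_
      gcongr
      refine ((θ (t • x)).le_of_opNorm_le (hb _ mx) x).trans ?_
      nlinarith
    have dz : ‖θ (t • z) z - θ (t • x) z‖ ≤ C * ‖h‖ := by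
      have := hlip _ mx _ mz
      rw [htz] at this
      calc _ ≤ (C * ‖h‖) * ‖z‖ :=
            (θ (t • z) - θ (t • x)).le_of_opNorm_le (this.trans (by gcongr)) z
        _ ≤ (C * ‖h‖) * 1 := by gcongr
        _ = _ := by ring
    have b1 : ‖(θ (t • z) z - θ (t • x) z - θ' (t • x) (t • h) z) * g t‖
        ≤ C * ‖h‖ ^ 2 * K := by
      have := htaylor _ mx _ mz
      rw [htz] at this
      refine (norm_mul_le _ _).trans ?_
      gcongr
      calc _ ≤ (C * ‖h‖ ^ 2) * ‖z‖ :=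
            (θ (t • z) - θ (t • x) - θ' (t • x) (t • h)).le_of_opNorm_le
              (this.trans (by gcongr)) z
        _ ≤ (C * ‖h‖ ^ 2) * 1 := by gcongr
        _ = _ := by ring
    have b2 : ‖t • (θ' (t • x) h h * g t)‖ ≤ C * ‖h‖ ^ 2 * K := by
      rw [norm_smul]
      have : ‖θ' (t • x) h h * g t‖ ≤ C * ‖h‖ * ‖h‖ * K := by
        refine (norm_mul_le _ _).trans ?_
        gcongr
        exact (θ' (t • x) h).le_of_opNorm_le ((θ' (t • x)).le_of_opNorm_le (hb' _ mx) h) h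
      nlinarith [norm_nonneg (θ' (t • x) h h * g t)]
    have b3 : ‖t • (θ (t • x) h * ((θ (t • z) z - θ (t • x) z + θ (t • x) h) * g t))‖
        ≤ 2 * C ^ 2 * ‖h‖ ^ 2 * K := by
      rw [norm_smul]
      have i0 : ‖θ (t • x) h‖ ≤ C * ‖h‖ := (θ (t • x)).le_of_opNorm_le (hb _ mx) h
      have i1 : ‖(θ (t • z) z - θ (t • x) z + θ (t • x) h) * g t‖ ≤ 2 * C * ‖h‖ * K := by
        refine (norm_mul_le _ _).trans ?_
        gcongr
        refine (norm_add_le _ _).trans ?_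
        linarith
      calc _ ≤ 1 * ((C * ‖h‖) * (2 * C * ‖h‖ * K)) := by
            gcongr
            exact (norm_mul_le _ _).trans (by gcongr)
        _ = _ := by ring
    rw [e]
    refine (norm_sub_le _ _).trans ?_
    have t1 := norm_add₃_le (a := θ (t • x) x * w t)
      (b := (θ (t • z) z - θ (t • x) z - θ' (t • x) (t • h) z) * g t)
      (c := t • (θ' (t • x) h h * g t))
    have hCC : C * (‖h‖ ^ 2 * K) ≤ C ^ 2 * (‖h‖ ^ 2 * K) := by
      gcongr; nlinarith
    have hp : 0 ≤ C ^ 2 * (‖h‖ ^ 2 * K) := by positivity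
    linarith
  have hcont : ContinuousOn w (Set.Icc 0 1) := fun t ht ↦ (hwd t ht).continuousWithinAt
  have fin := norm_le_gronwallBound_of_norm_deriv_right_le hcont
    (fun t ht ↦ hasDerivWithinAt_Ici_of_Icc (hwd t ⟨ht.1, ht.2.le⟩) ht)
    (by rw [hw0, norm_zero]) key 1 (by simp)
  have ew : w 1 = g 1 - f 1 - θ x (z - x) * g 1 := by simp [hw, hh]
  rw [← ew]
  refine fin.trans ?_
  rw [gronwallBound_of_K_ne_0 (by norm_num)]
  -- The Grönwall factor is `(exp(1/2) - 1) / (1/2)`, hence at most `2`.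
  have he : Real.exp (1 / 2 * (1 - 0)) ≤ 2 := by
    have := Real.exp_one_lt_d9
    have h2 : Real.exp (1 / 2 * (1 - 0)) ^ 2 = Real.exp 1 := by
      rw [← Real.exp_nat_mul]; norm_num
    nlinarith [Real.exp_pos (1 / 2 * (1 - 0))]
  have hp : 0 ≤ 10 * C ^ 2 * K * ‖h‖ ^ 2 := by positivity
  beta_reduce
  rw [zero_mul, zero_add]
  calc _ ≤ 10 * C ^ 2 * K * ‖h‖ ^ 2 / (1 / 2) * (2 - 1) := by gcongr
    _ = _ := by ring

theorem norm_ode_solution_le {A y : ℝ → L} (hb : ∀ t ∈ Set.Icc (0 : ℝ) 1, ‖A t‖ ≤ 1 / 2)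
    (hy : ∀ t ∈ Set.Icc (0 : ℝ) 1, HasDerivWithinAt y (A t * y t) (Set.Icc 0 1) t) :
    ∀ t ∈ Set.Icc (0 : ℝ) 1, ‖y t‖ ≤ ‖y 0‖ * Real.exp 1 := by
  intro t ht
  have hcont : ContinuousOn y (Set.Icc 0 1) := fun t ht ↦ (hy t ht).continuousWithinAt
  refine (norm_le_gronwallBound_of_norm_deriv_right_le (K := 1) (ε := 0) hcont
    (fun t ht ↦ hasDerivWithinAt_Ici_of_Icc (hy t ⟨ht.1, ht.2.le⟩) ht) le_rfl (fun t ht ↦ ?_)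
    t ht).trans ?_
  · have := hb t ⟨ht.1, ht.2.le⟩
    refine (norm_mul_le _ _).trans ?_
    nlinarith [norm_nonneg (y t)]
  · rw [gronwallBound_ε0]
    gcongr
    simpa using ht.2

/-- A flat linear system `du = θ u` with bounded coefficients on a small ball has a solution with
initial value `1`. -/
theorem exists_hasFDerivAt_of_flat_ball [CompleteSpace L]
    {θ : E → E →L[ℝ] L} {θ' : E → E →L[ℝ] E →L[ℝ] L}
    {r C : ℝ} (hr0 : 0 < r) (hr1 : r ≤ 1) (hC : 1 ≤ C) (hCr : C * r ≤ 1 / 2)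
    (hθ' : ∀ x ∈ Metric.ball (0 : E) r, HasFDerivAt θ (θ' x) x)
    (hb : ∀ x ∈ Metric.ball (0 : E) r, ‖θ x‖ ≤ C)
    (hb' : ∀ x ∈ Metric.ball (0 : E) r, ‖θ' x‖ ≤ C)
    (hlip : ∀ x ∈ Metric.ball (0 : E) r, ∀ y ∈ Metric.ball (0 : E) r, ‖θ y - θ x‖ ≤ C * ‖y - x‖)
    (htaylor : ∀ x ∈ Metric.ball (0 : E) r, ∀ y ∈ Metric.ball (0 : E) r,
      ‖θ y - θ x - θ' x (y - x)‖ ≤ C * ‖y - x‖ ^ 2)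
    (hflat : ∀ x ∈ Metric.ball (0 : E) r, ∀ v w : E,
      θ' x v w - θ' x w v = θ x v * θ x w - θ x w * θ x v) :
    ∃ u : E → L, u 0 = 1 ∧ ∀ x ∈ Metric.ball (0 : E) r,
      HasFDerivAt u (((ContinuousLinearMap.mul ℝ L).flip (u x)).comp (θ x)) x := by
  have hC0 : 0 ≤ C := by linarith
  have hmem : ∀ x ∈ Metric.ball (0 : E) r, ∀ t ∈ Set.Icc (0 : ℝ) 1,
      t • x ∈ Metric.ball (0 : E) r := by
    intro x hx t ht
    rw [mem_ball_zero_iff] at hx ⊢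
    rw [norm_smul, Real.norm_of_nonneg ht.1]
    nlinarith [ht.2, ht.1, norm_nonneg x]
  have hbA : ∀ x ∈ Metric.ball (0 : E) r, ∀ t ∈ Set.Icc (0 : ℝ) 1, ‖θ (t • x) x‖ ≤ 1 / 2 := by
    intro x hx t ht
    refine ((θ (t • x)).le_of_opNorm_le (hb _ (hmem x hx t ht)) x).trans ?_
    rw [mem_ball_zero_iff] at hx
    nlinarith
  have hex : ∀ x ∈ Metric.ball (0 : E) r, ∃ y : ℝ → L, y 0 = 1 ∧
      ∀ t ∈ Set.Icc (0 : ℝ) 1, HasDerivWithinAt y (θ (t • x) x * y t) (Set.Icc 0 1) t := by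
    intro x hx
    refine exists_linear_ode_solution (fun t ht ↦ ?_) (hbA x hx) 1
    have h1 : ContinuousAt (fun s : ℝ ↦ θ (s • x)) t :=
      ContinuousAt.comp (f := fun s : ℝ ↦ s • x) (hθ' _ (hmem x hx t ht)).continuousAt
        (by fun_prop)
    exact (h1.clm_apply continuousAt_const).continuousWithinAt
  choose! y hy0 hy using hex
  set K := ‖(1 : L)‖ * Real.exp 1 with hK
  have hyK : ∀ x ∈ Metric.ball (0 : E) r, ∀ t ∈ Set.Icc (0 : ℝ) 1, ‖y x t‖ ≤ K := by
    intro x hx t ht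
    have := norm_ode_solution_le (hbA x hx) (hy x hx) t ht
    rwa [hy0 x hx] at this
  have hK0 : 0 ≤ K := by positivity
  have herr : ∀ x ∈ Metric.ball (0 : E) r, ∀ z ∈ Metric.ball (0 : E) r,
      ‖y z 1 - y x 1 - θ x (z - x) * y z 1‖ ≤ 20 * C ^ 2 * K * ‖z - x‖ ^ 2 := fun x hx z hz ↦
    radial_solution_error hr1 hC hCr hθ' hb hb' hlip htaylor hflat hx hz
      ((hy0 x hx).trans (hy0 z hz).symm) (hy x hx) (hy z hz) (hyK z hz)
  refine ⟨fun x ↦ y x 1, ?_, fun x hx ↦ ?_⟩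
  · have h0 : (0 : E) ∈ Metric.ball (0 : E) r := Metric.mem_ball_self hr0
    have hd := hy 0 h0
    have hc : ∀ t ∈ Set.Icc (0 : ℝ) 1, y 0 t = y 0 0 := by
      refine constant_of_has_deriv_right_zero (fun t ht ↦ (hd t ht).continuousWithinAt)
        fun t ht ↦ ?_
      simpa using hasDerivWithinAt_Ici_of_Icc (hd t ⟨ht.1, ht.2.le⟩) ht
    exact (hc 1 (by simp)).trans (hy0 0 h0)
  · rw [hasFDerivAt_iff_isLittleO]
    have ho : (fun z : E ↦ ‖z - x‖ ^ 2) =o[𝓝 x] fun z ↦ z - x := by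
      have := (Asymptotics.isLittleO_norm_pow_id (E' := E) one_lt_two).comp_tendsto
        (f := _) (k := fun z : E ↦ z - x) (l' := 𝓝 x) (by
          have : Filter.Tendsto (fun z : E ↦ z - x) (𝓝 x) (𝓝 (x - x)) :=
            (continuous_id.sub continuous_const).tendsto x
          simpa using this)
      exact this
    refine Asymptotics.IsBigO.trans_isLittleO
      (Asymptotics.IsBigO.of_bound (20 * C ^ 2 * K + C * K) ?_) ho
    filter_upwards [Metric.isOpen_ball.mem_nhds hx] with z hz
    -- The two points are exchanged: the estimate carries the solution of its second point, so this
    -- order fixes `y x 1` and leaves `θ z`, which the Lipschitz bound replaces by `θ x` at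
    -- second-order cost.
    have h1 := herr z hz x hx
    have e : y z 1 - y x 1 - ((ContinuousLinearMap.mul ℝ L).flip (y x 1)).comp (θ x) (z - x)
        = -(y x 1 - y z 1 - θ z (x - z) * y x 1) + (θ z - θ x) (z - x) * y x 1 := by
      have : x - z = -(z - x) := by abel
      rw [this]
      simp only [ContinuousLinearMap.comp_apply, ContinuousLinearMap.flip_apply,
        ContinuousLinearMap.mul_apply', map_neg, sub_apply, neg_mul, sub_mul]
      abel
    rw [e, norm_pow, norm_norm]
    refine (norm_add_le _ _).trans ?_
    rw [norm_neg, add_mul]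
    refine add_le_add (by rwa [norm_sub_rev x z] at h1) ?_
    calc _ ≤ (C * ‖z - x‖ * ‖z - x‖) * K := by
          refine (norm_mul_le _ _).trans ?_
          gcongr
          · exact (θ z - θ x).le_of_opNorm_le (hlip x hx z hz) _
          · exact hyK x hx 1 (by simp)
      _ = _ := by ring

/-- A solution of a linear system `du = θ u` with smooth coefficients is smooth. -/
theorem contDiffOn_of_hasFDerivAt_mul {θ : E → E →L[ℝ] L} {U : Set E} (hU : IsOpen U)
    (hθ : ContDiffOn ℝ ∞ θ U) {u : E → L}
    (hu : ∀ x ∈ U, HasFDerivAt u (((ContinuousLinearMap.mul ℝ L).flip (u x)).comp (θ x)) x) :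
    ContDiffOn ℝ ∞ u U := by
  rw [contDiffOn_infty]
  -- Bootstrapping: the derivative is bilinear in `u` and `θ`, so it is as smooth as `u`.
  intro n
  induction n with
  | zero =>
    rw [Nat.cast_zero, contDiffOn_zero]
    exact fun x hx ↦ (hu x hx).continuousAt.continuousWithinAt
  | succ n ih =>
    rw [Nat.cast_succ, contDiffOn_succ_iff_fderiv_of_isOpen hU]
    refine ⟨fun x hx ↦ (hu x hx).differentiableAt.differentiableWithinAt, by simp, ?_⟩
    have h1 : ContDiffOn ℝ n
        (fun x ↦ ((ContinuousLinearMap.mul ℝ L).flip (u x)).comp (θ x)) U :=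
      ((ContinuousLinearMap.mul ℝ L).flip.contDiff.comp_contDiffOn ih).clm_comp
        (hθ.of_le (mod_cast le_top))
    exact h1.congr fun x hx ↦ (hu x hx).fderiv

/-- Bounds near a point for a twice continuously differentiable map and its derivative. -/
theorem exists_ball_bounds_of_contDiffAt {P : Type*} [NormedAddCommGroup P] [NormedSpace ℝ P]
    {f : E → P} {x₀ : E} (hf : ContDiffAt ℝ 2 f x₀) {U : Set E} (hU : U ∈ 𝓝 x₀) :
    ∃ C ε : ℝ, 1 ≤ C ∧ 0 < ε ∧ Metric.ball x₀ ε ⊆ U ∧ ∀ x ∈ Metric.ball x₀ ε,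
      HasFDerivAt f (fderiv ℝ f x) x ∧ ‖f x‖ ≤ C ∧ ‖fderiv ℝ f x‖ ≤ C ∧
      ∀ y ∈ Metric.ball x₀ ε, ‖f y - f x‖ ≤ C * ‖y - x‖ ∧
        ‖f y - f x - fderiv ℝ f x (y - x)‖ ≤ C * ‖y - x‖ ^ 2 := by
  have hc' : ContDiffAt ℝ 1 (fderiv ℝ f) x₀ := hf.fderiv_right (by norm_num)
  obtain ⟨K, t, ht, hK⟩ := hc'.exists_lipschitzOnWith
  -- One constant serves all the bounds: `K` is a local Lipschitz constant of the derivative, and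
  -- the summand `1` gives both `1 ≤ C` and strict inequalities at `x₀`.
  set C : ℝ := 1 + ‖f x₀‖ + ‖fderiv ℝ f x₀‖ + K with hCdef
  have n1 := norm_nonneg (f x₀)
  have n2 := norm_nonneg (fderiv ℝ f x₀)
  have n3 : (0 : ℝ) ≤ K := K.2
  have e1 : ∀ᶠ x in 𝓝 x₀, ‖f x‖ < C :=
    hf.continuousAt.norm.eventually_lt continuousAt_const (by simp only [hCdef]; linarith)
  have e2 : ∀ᶠ x in 𝓝 x₀, ‖fderiv ℝ f x‖ < C :=
    hc'.continuousAt.norm.eventually_lt continuousAt_const (by simp only [hCdef]; linarith)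
  have e3 : ∀ᶠ x in 𝓝 x₀, ContDiffAt ℝ 2 f x := hf.eventually (by simp)
  obtain ⟨ε, hε, hball⟩ := Metric.eventually_nhds_iff_ball.1
    (((e1.and e2).and e3).and (Filter.Eventually.and hU ht))
  have hd : ∀ x ∈ Metric.ball x₀ ε, HasFDerivAt f (fderiv ℝ f x) x := fun x hx ↦
    ((hball x hx).1.2.differentiableAt (by simp)).hasFDerivAt
  refine ⟨C, ε, by simp only [hCdef]; linarith, hε, fun x hx ↦ (hball x hx).2.1, fun x hx ↦
    ⟨hd x hx, (hball x hx).1.1.1.le, (hball x hx).1.1.2.le, fun y hy ↦ ⟨?_, ?_⟩⟩⟩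
  · exact (convex_ball x₀ ε).norm_image_sub_le_of_norm_hasFDerivWithin_le
      (fun z hz ↦ (hd z hz).hasFDerivWithinAt) (fun z hz ↦ (hball z hz).1.1.2.le) hx hy
  · have hseg : segment ℝ x y ⊆ Metric.ball x₀ ε := (convex_ball x₀ ε).segment_subset hx hy
    -- The mean value inequality is applied on the segment rather than the ball, since there the
    -- derivative varies by at most `C ‖y - x‖`; this yields the quadratic bound.
    have := (convex_segment (𝕜 := ℝ) x y).norm_image_sub_le_of_norm_hasFDerivWithin_le'
      (f := f) (f' := fderiv ℝ f) (φ := fderiv ℝ f x) (C := C * ‖y - x‖)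
      (fun z hz ↦ (hd z (hseg hz)).hasFDerivWithinAt) (fun z hz ↦ ?_)
      (left_mem_segment ℝ x y) (right_mem_segment ℝ x y)
    · rw [pow_two, ← mul_assoc]; exact this
    · have h1 := hK.dist_le_mul z (hball z (hseg hz)).2.2 x (hball x hx).2.2
      rw [dist_eq_norm, dist_eq_norm] at h1
      refine h1.trans ?_
      have h2 : ‖z - x‖ ≤ ‖y - x‖ := norm_sub_le_of_mem_segment hz
      have h3 : (K : ℝ) ≤ C := by simp only [hCdef]; linarith
      gcongr

/-- **Frobenius theorem** for linear systems: `du = θ u` is solvable near a point if `θ` is flat. -/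
theorem exists_hasFDerivAt_of_flat [CompleteSpace L] {θ : E → E →L[ℝ] L} {U : Set E}
    (hU : IsOpen U) (hθ : ContDiffOn ℝ ∞ θ U) {x₀ : E} (hx₀ : x₀ ∈ U)
    (hflat : ∀ x ∈ U, ∀ v w : E,
      fderiv ℝ θ x v w - fderiv ℝ θ x w v = θ x v * θ x w - θ x w * θ x v) :
    ∃ W : Set E, IsOpen W ∧ x₀ ∈ W ∧ W ⊆ U ∧ ∃ u : E → L, u x₀ = 1 ∧ ContDiffOn ℝ ∞ u W ∧
      ∀ x ∈ W, HasFDerivAt u (((ContinuousLinearMap.mul ℝ L).flip (u x)).comp (θ x)) x := by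
  have hc : ContDiffAt ℝ ∞ θ x₀ := hθ.contDiffAt (hU.mem_nhds hx₀)
  obtain ⟨C, ε, hC, hε, hεU, hball⟩ := exists_ball_bounds_of_contDiffAt
    (hc.of_le (WithTop.coe_le_coe.2 le_top)) (hU.mem_nhds hx₀)
  -- The second entry forces `C r ≤ 1/2`, and with `1 ≤ C` also `r ≤ 1`.
  set r := min ε (1 / (2 * C)) with hr
  have hr0 : 0 < r := by positivity
  have hrε : r ≤ ε := min_le_left _ _
  have hrC : C * r ≤ 1 / 2 := by
    calc C * r ≤ C * (1 / (2 * C)) := by gcongr; exact min_le_right _ _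
      _ = 1 / 2 := by field_simp
  have hr1 : r ≤ 1 := by nlinarith
  have hsub : Metric.ball x₀ r ⊆ Metric.ball x₀ ε := Metric.ball_subset_ball hrε
  have hsh : ∀ x ∈ Metric.ball (0 : E) r, x + x₀ ∈ Metric.ball x₀ ε := fun x hx ↦ hsub (by
    simpa [Metric.mem_ball, dist_eq_norm] using hx)
  obtain ⟨u, hu0, hu⟩ := exists_hasFDerivAt_of_flat_ball (θ := fun x ↦ θ (x + x₀))
    (θ' := fun x ↦ fderiv ℝ θ (x + x₀)) hr0 hr1 hC hrC
    (fun x hx ↦ (hasFDerivAt_comp_add_right x₀).2 (hball _ (hsh x hx)).1)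
    (fun x hx ↦ (hball _ (hsh x hx)).2.1) (fun x hx ↦ (hball _ (hsh x hx)).2.2.1)
    (fun x hx y hy ↦ by simpa using ((hball _ (hsh x hx)).2.2.2 _ (hsh y hy)).1)
    (fun x hx y hy ↦ by simpa using ((hball _ (hsh x hx)).2.2.2 _ (hsh y hy)).2)
    (fun x hx ↦ hflat _ (hεU (hsh x hx)))
  have hu' : ∀ x ∈ Metric.ball x₀ r, HasFDerivAt (fun z ↦ u (z - x₀))
      (((ContinuousLinearMap.mul ℝ L).flip (u (x - x₀))).comp (θ x)) x := by
    intro x hx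
    have := hu (x - x₀) (by simpa [Metric.mem_ball, dist_eq_norm] using hx)
    rw [sub_add_cancel] at this
    exact (hasFDerivAt_comp_sub x₀).2 this
  refine ⟨Metric.ball x₀ r, Metric.isOpen_ball, Metric.mem_ball_self hr0,
    hsub.trans hεU, fun z ↦ u (z - x₀), by simpa using hu0,
    contDiffOn_of_hasFDerivAt_mul Metric.isOpen_ball (hθ.mono (hsub.trans hεU)) hu', hu'⟩

end Frobenius

end CoherentTangent

namespace CoherentTangent

/-! ### Smooth sections, coordinates in a trivialization, and tensors tested on sections. -/

section Tools

set_option linter.unusedSectionVars false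

variable {E : Type*} [NormedAddCommGroup E] [NormedSpace ℝ E]
  {H : Type*} [TopologicalSpace H] {I : ModelWithCorners ℝ E H}
  {M : Type*} [TopologicalSpace M] [ChartedSpace H M]
  {F : Type*} [NormedAddCommGroup F] [NormedSpace ℝ F]
  {V : M → Type*} [TopologicalSpace (TotalSpace F V)] [∀ x, TopologicalSpace (V x)]
  [∀ x, AddCommGroup (V x)] [∀ x, Module ℝ (V x)]
  [FiberBundle F V] [VectorBundle ℝ F V]
  {F' : Type*} [NormedAddCommGroup F'] [NormedSpace ℝ F']
  {V' : M → Type*} [TopologicalSpace (TotalSpace F' V')] [∀ x, TopologicalSpace (V' x)]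
  [∀ x, AddCommGroup (V' x)] [∀ x, Module ℝ (V' x)]
  [FiberBundle F' V'] [VectorBundle ℝ F' V']

/-- The germ of a smooth section extends to a global smooth section. -/
theorem SmoothOn.exists_extension [IsManifold I ∞ M] [FiniteDimensional ℝ E] [T2Space M]
    {W : Set M} (hW : IsOpen W)
    {σ : Π x : M, V x} (hσ : SmoothOn I F W σ) {x : M} (hx : x ∈ W) :
    ∃ τ : Π x : M, V x, SmoothOn I F Set.univ τ ∧ ∀ᶠ y in 𝓝 x, τ y = σ y := by
  obtain ⟨f, -, hf⟩ := (SmoothBumpFunction.nhds_basis_tsupport (I := I) x).mem_iff.1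
    (hW.mem_nhds hx)
  refine ⟨(f : M → ℝ) • σ, contMDiffOn_univ.2 (ContMDiffOn.smul_section_of_tsupport
    f.contMDiff.contMDiffOn hW hf hσ), ?_⟩
  filter_upwards [f.eventuallyEq_one] with y hy
  simp [hy]

theorem SmoothOn.mono {U W : Set M} {σ : Π x : M, V x} (hσ : SmoothOn I F U σ) (h : W ⊆ U) :
    SmoothOn I F W σ := ContMDiffOn.mono hσ h

theorem smoothOn_trivial_iff {U : Set M} {f : M → F} :
    SmoothOn I F (V := fun _ : M ↦ F) U f ↔ ContMDiffOn I 𝓘(ℝ, F) ∞ f U := by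
  constructor
  · intro h x hx
    exact (contMDiffWithinAt_section.1 (h x hx))
  · intro h x hx
    exact contMDiffWithinAt_section.2 (h x hx)

/-- The section of `V` which is constant in the trivialization at `p`. -/
noncomputable def constSection (F : Type*) [NormedAddCommGroup F] [NormedSpace ℝ F]
    (V : M → Type*) [TopologicalSpace (TotalSpace F V)] [∀ x, TopologicalSpace (V x)]
    [∀ x, AddCommGroup (V x)] [∀ x, Module ℝ (V x)]
    [FiberBundle F V] [VectorBundle ℝ F V] (p : M) (w : F) (x : M) : V x :=
  (trivializationAt F V p).symmL ℝ x w

/-- The coordinate of a vector in the trivialization at `p`. -/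
noncomputable def coord (F : Type*) [NormedAddCommGroup F] [NormedSpace ℝ F]
    (V : M → Type*) [TopologicalSpace (TotalSpace F V)] [∀ x, TopologicalSpace (V x)]
    [∀ x, AddCommGroup (V x)] [∀ x, Module ℝ (V x)]
    [FiberBundle F V] [VectorBundle ℝ F V] (p : M) (x : M) : V x →L[ℝ] F :=
  (trivializationAt F V p).continuousLinearMapAt ℝ x

theorem coord_constSection {p x : M} (hx : x ∈ (trivializationAt F V p).baseSet) (w : F) :
    coord F V p x (constSection F V p w x) = w := by
  simp [coord, constSection, hx]

theorem constSection_coord {p x : M} (hx : x ∈ (trivializationAt F V p).baseSet) (v : V x) :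
    constSection F V p (coord F V p x v) x = v := by
  simp [coord, constSection, hx]

theorem coord_apply {p x : M} (hx : x ∈ (trivializationAt F V p).baseSet) (v : V x) :
    coord F V p x v = (trivializationAt F V p ⟨x, v⟩).2 := by
  simp [coord, hx]

section

variable [ContMDiffVectorBundle ∞ F V I] [ContMDiffVectorBundle ∞ F' V' I]

theorem smoothOn_iff_coord {p : M} {U : Set M} (hU : IsOpen U)
    (hp : U ⊆ (trivializationAt F V p).baseSet) {σ : Π x : M, V x} :
    SmoothOn I F U σ ↔ ContMDiffOn I 𝓘(ℝ, F) ∞ (fun x ↦ coord F V p x (σ x)) U := by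
  unfold SmoothOn
  rw [(trivializationAt F V p).contMDiffOn_section_iff hU hp]
  exact contMDiffOn_congr fun x hx ↦ (coord_apply (hp hx) _).symm

theorem smoothOn_constSection (p : M) (w : F) :
    SmoothOn I F (trivializationAt F V p).baseSet (constSection F V p w) := by
  rw [smoothOn_iff_coord (trivializationAt F V p).open_baseSet subset_rfl]
  exact contMDiffOn_const.congr fun x hx ↦ coord_constSection hx w

variable [∀ x, IsTopologicalAddGroup (V' x)] [∀ x, ContinuousSMul ℝ (V' x)]

/-- An operator-valued map is smooth if all its evaluations are. -/
theorem contMDiffOn_clm_of_apply [FiniteDimensional ℝ F] {U : Set M} {f : M → F →L[ℝ] F'}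
    (hf : ∀ w, ContMDiffOn I 𝓘(ℝ, F') ∞ (fun x ↦ f x w) U) :
    ContMDiffOn I 𝓘(ℝ, F →L[ℝ] F') ∞ f U := by
  let b := Module.finBasis ℝ F
  -- Expansion in a basis: `f` is a finite sum of fixed linear images of its values on basis
  -- vectors.
  have e : f = fun x ↦ ∑ i, ContinuousLinearMap.smulRightL ℝ F F'
      (LinearMap.toContinuousLinearMap (b.coord i)) (f x (b i)) := by
    ext x w
    conv_lhs => rw [← b.sum_repr w, map_sum]
    simp
  rw [e]
  exact contMDiffOn_finsetSum fun i _ ↦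
    (ContinuousLinearMap.contMDiff _).comp_contMDiffOn (hf (b i))

/-- A section of a bundle of homomorphisms is smooth if it maps smooth local sections to smooth
local sections. -/
theorem smoothOn_hom_of_apply [FiniteDimensional ℝ F] {U : Set M} (hU : IsOpen U)
    {T : Π x : M, V x →L[ℝ] V' x}
    (hT : ∀ W ⊆ U, IsOpen W → ∀ σ : Π x : M, V x, SmoothOn I F W σ →
      SmoothOn I F' W (fun x ↦ T x (σ x))) :
    SmoothOn I (F →L[ℝ] F') (V := fun x ↦ V x →L[ℝ] V' x) U T := by
  intro p hp
  set W := U ∩ ((trivializationAt F V p).baseSet ∩ (trivializationAt F' V' p).baseSet) with hWdef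
  have hW : IsOpen W := hU.inter ((trivializationAt F V p).open_baseSet.inter
    (trivializationAt F' V' p).open_baseSet)
  have hpW : p ∈ W := ⟨hp, FiberBundle.mem_baseSet_trivializationAt' p,
    FiberBundle.mem_baseSet_trivializationAt' p⟩
  refine ContMDiffAt.contMDiffWithinAt ?_
  rw [contMDiffAt_hom_bundle]
  refine ⟨contMDiffAt_id, ?_⟩
  have h1 : ContMDiffOn I 𝓘(ℝ, F →L[ℝ] F') ∞
      (fun x ↦ (coord F' V' p x).comp ((T x).comp ((trivializationAt F V p).symmL ℝ x))) W := by
    refine contMDiffOn_clm_of_apply fun w ↦ ?_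
    exact (smoothOn_iff_coord hW fun x hx ↦ hx.2.2).1
      (hT W (fun x hx ↦ hx.1) hW _ ((smoothOn_constSection p w).mono fun x hx ↦ hx.2.1))
  refine (h1.contMDiffAt (hW.mem_nhds hpW)).congr_of_eventuallyEq ?_
  filter_upwards [hW.mem_nhds hpW] with x hx
  simp [ContinuousLinearMap.inCoordinates, coord]

end

theorem SmoothOn.apply [∀ x, IsTopologicalAddGroup (V' x)] [∀ x, ContinuousSMul ℝ (V' x)]
    {U : Set M} {T : Π x : M, V x →L[ℝ] V' x}
    (hT : SmoothOn I (F →L[ℝ] F') (V := fun x ↦ V x →L[ℝ] V' x) U T) {σ : Π x : M, V x}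
    (hσ : SmoothOn I F U σ) : SmoothOn I F' U (fun x ↦ T x (σ x)) :=
  ContMDiffOn.clm_bundle_apply hT hσ

/-- The derivative of a smooth function along a smooth vector field is smooth. -/
theorem contMDiffOn_mvfderiv_apply [IsManifold I ∞ M] {U : Set M} (hU : IsOpen U) {f : M → F}
    (hf : ContMDiffOn I 𝓘(ℝ, F) ∞ f U) {X : Π x : M, TangentSpace I x} (hX : SmoothOn I E U X) :
    ContMDiffOn I 𝓘(ℝ, F) ∞ (fun x ↦ mvfderiv I f x (X x)) U := by
  -- The derivative along `X` is the fibre component of the tangent map of `f` composed with `X`.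
  have h1 := ContMDiffOn.contMDiffOn_tangentMapWithin (m := ∞) hf (by simp) hU.uniqueMDiffOn
  have h2 := h1.comp hX (fun x hx ↦ hx)
  intro x hx
  have h3 := (contMDiffWithinAt_totalSpace.1 (h2 x hx)).2
  refine h3.congr_of_mem (fun y hy ↦ ?_) hx
  simp [tangentMapWithin, mfderivWithin_of_isOpen hU hy, mvfderiv]
  rfl

section Tensors

variable [IsManifold I ∞ M] [FiniteDimensional ℝ E] [FiniteDimensional ℝ F]
  [∀ x, IsTopologicalAddGroup (V x)] [∀ x, ContinuousSMul ℝ (V x)] [ContMDiffVectorBundle ∞ F V I]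

theorem smoothBundleMapOn_of_apply {U : Set M} (hU : IsOpen U)
    {φ : Π x : M, TangentSpace I x →L[ℝ] V x}
    (h : ∀ W ⊆ U, IsOpen W → ∀ X : Π x : M, TangentSpace I x, SmoothOn I E W X →
      SmoothOn I F W (fun x ↦ φ x (X x))) : SmoothBundleMapOn I F U φ :=
  smoothOn_hom_of_apply hU h

theorem SmoothBundleMapOn.apply {U : Set M} {φ : Π x : M, TangentSpace I x →L[ℝ] V x}
    (h : SmoothBundleMapOn I F U φ) {X : Π x : M, TangentSpace I x} (hX : SmoothOn I E U X) :
    SmoothOn I F U (fun x ↦ φ x (X x)) :=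
  SmoothOn.apply h hX

theorem smoothDualSectionOn_of_apply {U : Set M} (hU : IsOpen U) {ρ : Π x : M, V x →L[ℝ] ℝ}
    (h : ∀ W ⊆ U, IsOpen W → ∀ σ : Π x : M, V x, SmoothOn I F W σ →
      ContMDiffOn I 𝓘(ℝ, ℝ) ∞ (fun x ↦ ρ x (σ x)) W) : SmoothDualSectionOn I F U ρ :=
  smoothOn_hom_of_apply (V' := fun _ : M ↦ ℝ) hU fun W hWU hW σ hσ ↦
    smoothOn_trivial_iff.2 (h W hWU hW σ hσ)

theorem SmoothDualSectionOn.apply {U : Set M} {ρ : Π x : M, V x →L[ℝ] ℝ}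
    (h : SmoothDualSectionOn I F U ρ) {σ : Π x : M, V x} (hσ : SmoothOn I F U σ) :
    ContMDiffOn I 𝓘(ℝ, ℝ) ∞ (fun x ↦ ρ x (σ x)) U :=
  smoothOn_trivial_iff.1 (SmoothOn.apply (V' := fun _ : M ↦ ℝ) h hσ)

theorem smoothTensorOn_of_apply {U : Set M} (hU : IsOpen U)
    {A : Π x : M, TangentSpace I x →L[ℝ] V x →L[ℝ] ℝ}
    (h : ∀ W ⊆ U, IsOpen W → ∀ (X : Π x : M, TangentSpace I x) (σ : Π x : M, V x),
      SmoothOn I E W X → SmoothOn I F W σ →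
      ContMDiffOn I 𝓘(ℝ, ℝ) ∞ (fun x ↦ A x (X x) (σ x)) W) : SmoothTensorOn I F U A :=
  smoothOn_hom_of_apply (V' := fun x : M ↦ V x →L[ℝ] ℝ) hU fun _ hWU hW X hX ↦
    smoothDualSectionOn_of_apply hW fun W' hW' hW'o σ hσ ↦
      h W' (hW'.trans hWU) hW'o X σ (hX.mono hW') hσ

theorem SmoothTensorOn.apply {U : Set M} {A : Π x : M, TangentSpace I x →L[ℝ] V x →L[ℝ] ℝ}
    (h : SmoothTensorOn I F U A) {X : Π x : M, TangentSpace I x} {σ : Π x : M, V x}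
    (hX : SmoothOn I E U X) (hσ : SmoothOn I F U σ) :
    ContMDiffOn I 𝓘(ℝ, ℝ) ∞ (fun x ↦ A x (X x) (σ x)) U :=
  SmoothDualSectionOn.apply (SmoothOn.apply (V' := fun x : M ↦ V x →L[ℝ] ℝ) h hX) hσ

end Tensors

end Tools

end CoherentTangent

namespace CoherentTangent

/-! ### Lie brackets as commutators, and the Frobenius theorem on a manifold. -/

section Calculus

set_option linter.unusedSectionVars false

variable {E : Type*} [NormedAddCommGroup E] [NormedSpace ℝ E] [FiniteDimensional ℝ E]
  {H : Type*} [TopologicalSpace H] {I : ModelWithCorners ℝ E H}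
  {M : Type*} [TopologicalSpace M] [ChartedSpace H M] [IsManifold I ∞ M]

theorem minSmoothness_natCast_le (n : ℕ) : minSmoothness ℝ n ≤ ∞ := by
  rw [minSmoothness_of_isRCLikeNormedField]
  exact WithTop.coe_le_coe.2 (le_top : (n : ℕ∞) ≤ ⊤)

theorem isManifold_minSmoothness (n : ℕ) : IsManifold I (minSmoothness ℝ n) M :=
  IsManifold.of_le (minSmoothness_natCast_le n)

/-- The Lie bracket of vector fields is the commutator of the derivations. -/
theorem mvfderiv_mlieBracket_apply {U : Set M} (hU : IsOpen U) {f : M → ℝ}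
    (hf : ContMDiffOn I 𝓘(ℝ, ℝ) ∞ f U) {X Y : Π x : M, TangentSpace I x}
    (hX : SmoothOn I E U X) (hY : SmoothOn I E U Y) {x : M} (hx : x ∈ U) :
    mvfderiv I f x (mlieBracket I X Y x) =
      mvfderiv I (fun y ↦ mvfderiv I f y (Y y)) x (X x)
        - mvfderiv I (fun y ↦ mvfderiv I f y (X y)) x (Y x) := by
  have := isManifold_minSmoothness (I := I) (M := M) 3
  have := isManifold_minSmoothness (I := I) (M := M) 2
  -- The argument below needs a vector field with nonzero value at `x`; over a zero model space
  -- there is none, but all tangent vectors vanish.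
  rcases subsingleton_or_nontrivial E with hE | hE
  · have hs : ∀ v : TangentSpace I x, v = 0 := fun v ↦ Subsingleton.elim (α := E) v 0
    rw [hs (mlieBracket I X Y x), hs (X x), hs (Y x)]
    simp
  obtain ⟨e, he⟩ := exists_ne (0 : E)
  set U' := U ∩ (trivializationAt E (TangentSpace I) x).baseSet with hU'
  have hU'o : IsOpen U' := hU.inter (trivializationAt E (TangentSpace I) x).open_baseSet
  have hxU' : x ∈ U' := ⟨hx, FiberBundle.mem_baseSet_trivializationAt' x⟩
  set Z := constSection E (TangentSpace I : M → Type _) x e with hZdef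
  have hZ : SmoothOn I E U' Z := (smoothOn_constSection x e).mono Set.inter_subset_right
  have hZx : Z x ≠ 0 := by
    intro h0
    apply he
    rw [← coord_constSection (V := (TangentSpace I : M → Type _)) hxU'.2 e, ← hZdef, h0, map_zero]
  have hX' := hX.mono (Set.inter_subset_left : U' ⊆ U)
  have hY' := hY.mono (Set.inter_subset_left : U' ⊆ U)
  have hf' := hf.mono (Set.inter_subset_left : U' ⊆ U)
  have c2 : ∀ {W : Π x : M, TangentSpace I x}, SmoothOn I E U' W →
      ContMDiffAt I I.tangent (minSmoothness ℝ 2) (fun y ↦ (W y : TangentBundle I M)) x :=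
    fun hW ↦ ((hW x hxU').contMDiffAt (hU'o.mem_nhds hxU')).of_le
      (minSmoothness_natCast_le 2)
  have hfZ : SmoothOn I E U' (f • Z) := ContMDiffOn.smul_section hf' hZ
  have d : ∀ {W : Π x : M, TangentSpace I x}, SmoothOn I E U' W → ∀ {y : M}, y ∈ U' →
      MDifferentiableAt I I.tangent (fun y ↦ (W y : TangentBundle I M)) y :=
    fun hW y hy ↦ hW.mdifferentiableAt hU'o hy
  have df : ∀ {g : M → ℝ}, ContMDiffOn I 𝓘(ℝ, ℝ) ∞ g U' → ∀ {y : M}, y ∈ U' →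
      MDifferentiableAt I 𝓘(ℝ, ℝ) g y :=
    fun hg y hy ↦ ((hg y hy).contMDiffAt (hU'o.mem_nhds hy)).mdifferentiableAt (by simp)
  have br : ∀ {W W' : Π x : M, TangentSpace I x}, SmoothOn I E U' W → SmoothOn I E U' W' →
      SmoothOn I E U' (mlieBracket I W W') := by
    intro W W' hW hW' y hy
    have : IsManifold I (((⊤ : ℕ∞) : WithTop ℕ∞) + 1) M := by simpa
    exact (ContMDiffAt.mlieBracket_vectorField (m := ⊤) (n := ⊤)
      ((hW y hy).contMDiffAt (hU'o.mem_nhds hy)) ((hW' y hy).contMDiffAt (hU'o.mem_nhds hy))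
      (by simp)).contMDiffWithinAt
  -- The identity is extracted from the Jacobi identity: expand it for `X, Y, fZ` by the Leibniz
  -- rule and subtract `f` times the one for `X, Y, Z`. The mixed terms cancel, and what remains is
  -- the claimed identity multiplied by `Z x ≠ 0`.
  have J1 := leibniz_identity_mlieBracket_apply (c2 hX') (c2 hY') (c2 hfZ)
  have J2 := leibniz_identity_mlieBracket_apply (c2 hX') (c2 hY') (c2 hZ)
  have step : ∀ {W W' : Π x : M, TangentSpace I x}, SmoothOn I E U' W → SmoothOn I E U' W' →
      mlieBracket I W (mlieBracket I W' (f • Z)) x =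
        mvfderiv I (fun y ↦ mvfderiv I f y (W' y)) x (W x) • Z x
        + mvfderiv I f x (W' x) • mlieBracket I W Z x
        + mvfderiv I f x (W x) • mlieBracket I W' Z x
        + f x • mlieBracket I W (mlieBracket I W' Z) x := by
    intro W W' hW hW'
    have e1 : mlieBracket I W' (f • Z) =ᶠ[𝓝 x]
        ((fun y ↦ mvfderiv I f y (W' y)) • Z + f • mlieBracket I W' Z) := by
      filter_upwards [hU'o.mem_nhds hxU'] with y hy
      rw [mlieBracket_smul_right (df hf' hy) (d hZ hy)]
      rfl
    have hg := contMDiffOn_mvfderiv_apply hU'o hf' hW'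
    rw [Filter.EventuallyEq.mlieBracket_vectorField_eq (Filter.EventuallyEq.refl _ W) e1,
      mlieBracket_add_right (d (ContMDiffOn.smul_section hg hZ) hxU')
        (d (ContMDiffOn.smul_section hf' (br hW' hZ)) hxU'),
      mlieBracket_smul_right (df hg hxU') (d hZ hxU'),
      mlieBracket_smul_right (df hf' hxU') (d (br hW' hZ) hxU')]
    abel
  rw [step hX' hY', step hY' hX', mlieBracket_smul_right (df hf' hxU') (d hZ hxU'), J2] at J1
  have J3 : (mvfderiv I (fun y ↦ mvfderiv I f y (Y y)) x (X x)
        - mvfderiv I (fun y ↦ mvfderiv I f y (X y)) x (Y x)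
        - mvfderiv I f x (mlieBracket I X Y x)) • Z x = 0 := by
    rw [sub_smul, sub_smul]
    have := sub_eq_zero.2 J1
    rw [← this]
    module
  rcases smul_eq_zero.1 J3 with h | h
  · linarith
  · exact absurd h hZx

theorem mvfderiv_congr {F : Type*} [NormedAddCommGroup F] [NormedSpace ℝ F] {f g : M → F} {x : M}
    (h : f =ᶠ[𝓝 x] g) : mvfderiv I f x = mvfderiv I g x := by
  ext v
  have h2 := congr($(h.mfderiv_eq (I := I) (I' := 𝓘(ℝ, F))) v)
  exact h2

theorem mvfderiv_clm_comp {F F' : Type*} [NormedAddCommGroup F] [NormedSpace ℝ F]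
    [NormedAddCommGroup F'] [NormedSpace ℝ F'] (ℓ : F →L[ℝ] F') {f : M → F} {x : M}
    (hf : MDifferentiableAt I 𝓘(ℝ, F) f x) (v : TangentSpace I x) :
    mvfderiv I (fun y ↦ ℓ (f y)) x v = ℓ (mvfderiv I f x v) := by
  have := mfderiv_comp x (ℓ.mdifferentiableAt (x := f x)) hf
  have h2 := congr($this v)
  simp only [ContinuousLinearMap.mfderiv_eq] at h2
  exact h2

section Coordinates

theorem coord_tangent_eq {p x : M} (hx : x ∈ (trivializationAt E (TangentSpace I) p).baseSet) :
    coord E (TangentSpace I) p x = mfderiv I 𝓘(ℝ, E) (extChartAt I p) x :=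
  TangentBundle.continuousLinearMapAt_trivializationAt (by simpa using hx)

/-- The coordinate vector fields of a chart commute. -/
theorem mlieBracket_constSection {p x : M} (hx : x ∈ (trivializationAt E (TangentSpace I) p).baseSet) (v w : E) :
    mlieBracket I (constSection E (TangentSpace I) p v) (constSection E (TangentSpace I) p w) x = 0 := by
  set U := (trivializationAt E (TangentSpace I) p).baseSet with hU
  have hUo : IsOpen U := (trivializationAt E (TangentSpace I) p).open_baseSet
  have hsrc : U = (chartAt H p).source := by simp [hU]
  have hψ : ContMDiffOn I 𝓘(ℝ, E) ∞ (extChartAt I p) U := hsrc ▸ contMDiffOn_extChartAt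
  -- The bracket is tested on the functions `ℓ ∘ ψ`, with `ψ` the chart: their derivatives along
  -- coordinate fields are constant, so the commutator of derivations kills them.
  have key : coord E (TangentSpace I) p x (mlieBracket I (constSection E (TangentSpace I) p v) (constSection E (TangentSpace I) p w) x) = 0 := by
    refine SeparatingDual.eq_zero_of_forall_dual_eq_zero (R := ℝ) fun ℓ ↦ ?_
    have hf : ContMDiffOn I 𝓘(ℝ, ℝ) ∞ (fun y ↦ ℓ (extChartAt I p y)) U :=
      (ContinuousLinearMap.contMDiff ℓ).comp_contMDiffOn hψ
    have hd : ∀ y ∈ U, ∀ u : TangentSpace I y,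
        mvfderiv I (fun y ↦ ℓ (extChartAt I p y)) y u = ℓ (coord E (TangentSpace I) p y u) := by
      intro y hy u
      rw [mvfderiv_clm_comp ℓ (((hψ y hy).contMDiffAt
        (hUo.mem_nhds hy)).mdifferentiableAt (by simp)), coord_tangent_eq hy]
      rfl
    have hconst : ∀ a b : E, mvfderiv I (fun y ↦ mvfderiv I (fun y ↦ ℓ (extChartAt I p y)) y
        (constSection E (TangentSpace I) p a y)) x (constSection E (TangentSpace I) p b x) = 0 := by
      intro a b
      have e : (fun y ↦ mvfderiv I (fun y ↦ ℓ (extChartAt I p y)) y (constSection E (TangentSpace I) p a y))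
          =ᶠ[𝓝 x] fun _ ↦ ℓ a := by
        filter_upwards [hUo.mem_nhds hx] with y hy
        rw [hd y hy, coord_constSection hy]
      rw [mvfderiv_congr e, mvfderiv_const]
      rfl
    rw [← hd x hx, mvfderiv_mlieBracket_apply hUo hf (smoothOn_constSection p v)
      (smoothOn_constSection p w) hx, hconst, hconst, sub_zero]
  rw [← constSection_coord hx (mlieBracket I _ _ x), key]
  simp [constSection]

variable {L : Type*} [NormedRing L] [NormedAlgebra ℝ L] [CompleteSpace L]

/-- **Frobenius theorem** for linear systems on a manifold: `du = θ u` is solvable near `p` if `θ`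
is flat. -/
theorem exists_mvfderiv_eq_of_flat [I.Boundaryless] {p : M} {U : Set M} (hU : IsOpen U)
    (hp : p ∈ U) (hUp : U ⊆ (trivializationAt E (TangentSpace I) p).baseSet) (θ : Π x : M, TangentSpace I x →L[ℝ] L)
    (hθ : ∀ v, ContMDiffOn I 𝓘(ℝ, L) ∞ (fun x ↦ θ x (constSection E (TangentSpace I) p v x)) U)
    (hflat : ∀ x ∈ U, ∀ v w : E,
      mvfderiv I (fun y ↦ θ y (constSection E (TangentSpace I) p w y)) x (constSection E (TangentSpace I) p v x)
        - mvfderiv I (fun y ↦ θ y (constSection E (TangentSpace I) p v y)) x (constSection E (TangentSpace I) p w x) =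
      θ x (constSection E (TangentSpace I) p v x) * θ x (constSection E (TangentSpace I) p w x)
        - θ x (constSection E (TangentSpace I) p w x) * θ x (constSection E (TangentSpace I) p v x)) :
    ∃ W : Set M, IsOpen W ∧ p ∈ W ∧ W ⊆ U ∧ ∃ u : M → L, u p = 1 ∧
      ContMDiffOn I 𝓘(ℝ, L) ∞ u W ∧ ∀ x ∈ W, ∀ X : TangentSpace I x,
        mvfderiv I u x X = θ x X * u x := by
  set ψ := extChartAt I p with hψdef
  have hsrc : (trivializationAt E (TangentSpace I) p).baseSet = (chartAt H p).source := by simp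
  have hUs : U ⊆ ψ.source := by rw [hψdef, extChartAt_source, ← hsrc]; exact hUp
  set D : Set E := ψ.target ∩ ψ.symm ⁻¹' U with hD
  have hDo : IsOpen D :=
    (continuousOn_extChartAt_symm p).isOpen_inter_preimage (isOpen_extChartAt_target p) hU
  have hψs : ContMDiffOn 𝓘(ℝ, E) I ∞ ψ.symm ψ.target := contMDiffOn_extChartAt_symm p
  have hpD : ψ p ∈ D := ⟨mem_extChartAt_target p, by simpa [hψdef] using hp⟩
  -- The form `θ` read in the chart, where the coordinate fields become constant vectors and
  -- flatness takes the form used in the normed space.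
  set Θ : E → E →L[ℝ] L := fun z ↦
    (θ (ψ.symm z)).comp ((trivializationAt E (TangentSpace I) p).symmL ℝ (ψ.symm z)) with hΘ
  have hΘs : ContDiffOn ℝ ∞ Θ D := by
    rw [contDiffOn_clm_apply]
    intro v
    rw [← contMDiffOn_iff_contDiffOn]
    exact (hθ v).comp (hψs.mono Set.inter_subset_left) fun z hz ↦ hz.2
  have hder : ∀ z ∈ D, ∀ v w : E, fderiv ℝ Θ z v w =
      mvfderiv I (fun y ↦ θ y (constSection E (TangentSpace I) p w y)) (ψ.symm z)
        (constSection E (TangentSpace I) p v (ψ.symm z)) := by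
    intro z hz v w
    have h1 : fderiv ℝ (fun z ↦ Θ z w) z v = fderiv ℝ Θ z v w := by
      have hd : DifferentiableAt ℝ Θ z :=
        (hΘs.contDiffAt (hDo.mem_nhds hz)).differentiableAt (by simp)
      have := (hd.hasFDerivAt.clm_apply (hasFDerivAt_const w z)).fderiv
      rw [this]; simp
    have hs : MDifferentiableAt 𝓘(ℝ, E) I ψ.symm z :=
      ((hψs z hz.1).contMDiffAt ((isOpen_extChartAt_target p).mem_nhds hz.1)).mdifferentiableAt
        (by simp)
    have hg : MDifferentiableAt I 𝓘(ℝ, L) (fun y ↦ θ y (constSection E (TangentSpace I) p w y)) (ψ.symm z) :=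
      ((hθ w _ hz.2).contMDiffAt (hU.mem_nhds hz.2)).mdifferentiableAt (by simp)
    have h2 := congr($(mfderiv_comp z hg hs) v)
    have h3 : constSection E (TangentSpace I) p v (ψ.symm z) = mfderiv 𝓘(ℝ, E) I ψ.symm z v := by
      have hm : ψ.symm z ∈ (chartAt H p).source := by rw [← hsrc]; exact hUp hz.2
      rw [constSection, TangentBundle.symmL_trivializationAt hm, I.range_eq_univ,
        mfderivWithin_univ]
      change mfderiv 𝓘(ℝ, E) I ψ.symm (ψ (ψ.symm z)) v = _
      rw [ψ.right_inv hz.1]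
    rw [← h1, h3]
    rw [mfderiv_eq_fderiv] at h2
    exact h2
  obtain ⟨W, hWo, hpW, hWD, u, hu1, hus, hu⟩ := exists_hasFDerivAt_of_flat hDo hΘs hpD
    (fun z hz v w ↦ by rw [hder z hz, hder z hz]; exact hflat _ hz.2 v w)
  have hψc : ContMDiffOn I 𝓘(ℝ, E) ∞ ψ ψ.source := by
    rw [hψdef, extChartAt_source]; exact contMDiffOn_extChartAt
  have hsubs : ψ.source ∩ ψ ⁻¹' W ⊆ U := fun x hx ↦ by
    have := (hWD hx.2).2
    rwa [Set.mem_preimage, ψ.left_inv hx.1] at this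
  refine ⟨ψ.source ∩ ψ ⁻¹' W,
    (continuousOn_extChartAt p).isOpen_inter_preimage (isOpen_extChartAt_source p) hWo,
    ⟨mem_extChartAt_source p, hpW⟩, hsubs, fun x ↦ u (ψ x), hu1, ?_, ?_⟩
  · exact (contMDiffOn_iff_contDiffOn.2 hus).comp (hψc.mono Set.inter_subset_left)
      fun x hx ↦ hx.2
  · intro x hx X
    have hxb := hUp (hsubs hx)
    have hm : MDifferentiableAt I 𝓘(ℝ, E) ψ x :=
      ((hψc x hx.1).contMDiffAt ((isOpen_extChartAt_source p).mem_nhds hx.1)).mdifferentiableAt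
        (by simp)
    have hum := hu (ψ x) hx.2
    have h2 := congr($(mfderiv_comp x hum.hasMFDerivAt.mdifferentiableAt hm) X)
    have h3 : mvfderiv I (fun x ↦ u (ψ x)) x X = fderiv ℝ u (ψ x) (coord E (TangentSpace I) p x X) := by
      rw [coord_tangent_eq hxb, ← mfderiv_eq_fderiv]
      exact h2
    rw [h3, hum.fderiv]
    simp only [ContinuousLinearMap.comp_apply, ContinuousLinearMap.flip_apply,
      ContinuousLinearMap.mul_apply', hΘ]
    rw [ψ.left_inv hx.1]
    congr 2
    exact constSection_coord hxb X

end Coordinates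

end Calculus

end CoherentTangent

namespace CoherentTangent

/-! ### Germ dependence, restriction to smaller open sets, and projective changes. -/

section Connections

set_option linter.unusedSectionVars false

variable {E : Type*} [NormedAddCommGroup E] [NormedSpace ℝ E] [FiniteDimensional ℝ E]
  {H : Type*} [TopologicalSpace H] {I : ModelWithCorners ℝ E H}
  {M : Type*} [TopologicalSpace M] [ChartedSpace H M] [IsManifold I ∞ M]
  {F : Type*} [NormedAddCommGroup F] [NormedSpace ℝ F] [FiniteDimensional ℝ F]
  {V : M → Type*} [TopologicalSpace (TotalSpace F V)] [∀ x, TopologicalSpace (V x)]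
  [∀ x, AddCommGroup (V x)] [∀ x, Module ℝ (V x)]
  [∀ x, IsTopologicalAddGroup (V x)] [∀ x, ContinuousSMul ℝ (V x)]
  [FiberBundle F V] [VectorBundle ℝ F V] [ContMDiffVectorBundle ∞ F V I]
  {cov : (Π x : M, V x) → (Π x : M, TangentSpace I x →L[ℝ] V x)}
  {φ : Π x : M, TangentSpace I x →L[ℝ] V x}
  {U W : Set M}

theorem IsConnectionOn.congr_of_eventuallyEq (h : IsConnectionOn I F W cov) (hW : IsOpen W)
    {σ τ : Π x : M, V x} (hσ : SmoothOn I F W σ) (hτ : SmoothOn I F W τ) {x : M} (hx : x ∈ W)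
    (e : ∀ᶠ y in 𝓝 x, σ y = τ y) : cov σ x = cov τ x :=
  h.covariant.congr_of_eventuallyEq (hσ.mdifferentiableAt hW hx) (hτ.mdifferentiableAt hW hx)
    (hW.mem_nhds hx) e

/-- The curvature at a point depends only on the germs of its arguments. -/
theorem curvature_eq_of_eventuallyEq (hW : IsOpen W) (h : IsConnectionOn I F W cov)
    {X X' Y Y' : Π x : M, TangentSpace I x} {σ σ' : Π x : M, V x}
    (hX : SmoothOn I E W X) (hX' : SmoothOn I E W X') (hY : SmoothOn I E W Y)
    (hY' : SmoothOn I E W Y') (hσ : SmoothOn I F W σ) (hσ' : SmoothOn I F W σ') {x : M}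
    (hx : x ∈ W) (eX : ∀ᶠ y in 𝓝 x, X y = X' y) (eY : ∀ᶠ y in 𝓝 x, Y y = Y' y)
    (eσ : ∀ᶠ y in 𝓝 x, σ y = σ' y) :
    curvature I cov X Y σ x = curvature I cov X' Y' σ' x := by
  have key : ∀ {Z Z' : Π x : M, TangentSpace I x}, SmoothOn I E W Z → SmoothOn I E W Z' →
      (∀ᶠ y in 𝓝 x, Z y = Z' y) →
      cov (fun y ↦ cov σ y (Z y)) x = cov (fun y ↦ cov σ' y (Z' y)) x := by
    intro Z Z' hZ hZ' eZ
    refine h.congr_of_eventuallyEq hW (h.smoothOn_apply hW subset_rfl hσ hZ)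
      (h.smoothOn_apply hW subset_rfl hσ' hZ') hx ?_
    filter_upwards [eZ, eσ.eventually_nhds, hW.mem_nhds hx] with y h1 h2 h3
    rw [h1, h.congr_of_eventuallyEq hW hσ hσ' h3 h2]
  have hb : mlieBracket I X Y x = mlieBracket I X' Y' x :=
    Filter.EventuallyEq.mlieBracket_vectorField_eq eX eY
  rw [curvature, curvature, key hX hX' eX, key hY hY' eY, hb, eX.self_of_nhds, eY.self_of_nhds,
    h.congr_of_eventuallyEq hW hσ hσ' hx eσ]

theorem SmoothBundleMapOn.mono (h : SmoothBundleMapOn I F U φ) (hWU : W ⊆ U) :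
    SmoothBundleMapOn I F W φ := SmoothOn.mono (V := fun x : M ↦ TangentSpace I x →L[ℝ] V x) h hWU

theorem SmoothDualSectionOn.mono {ρ : Π x : M, V x →L[ℝ] ℝ} (h : SmoothDualSectionOn I F U ρ)
    (hWU : W ⊆ U) : SmoothDualSectionOn I F W ρ :=
  SmoothOn.mono (V := fun x : M ↦ V x →L[ℝ] ℝ) h hWU

theorem SmoothTensorOn.mono {A : Π x : M, TangentSpace I x →L[ℝ] V x →L[ℝ] ℝ}
    (h : SmoothTensorOn I F U A) (hWU : W ⊆ U) : SmoothTensorOn I F W A :=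
  SmoothOn.mono (V := fun x : M ↦ TangentSpace I x →L[ℝ] V x →L[ℝ] ℝ) h hWU

section Mono

variable [T2Space M]

/-- Restriction is not formal, because the condition only tests fields smooth on all of `U`.
Arguments smooth on `W` are replaced near the point by global ones with the same germs. The torsion
and Codazzi conditions restrict in the same way. -/
theorem CurvatureFormulaOn.mono {n : ℕ} {A : Π x : M, TangentSpace I x →L[ℝ] V x →L[ℝ] ℝ}
    (hA : CurvatureFormulaOn I F n U φ cov A) (hW : IsOpen W) (hWU : W ⊆ U)
    (h : IsConnectionOn I F W cov) : CurvatureFormulaOn I F n W φ cov A := by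
  intro X Y σ hX hY hσ x hx
  obtain ⟨X', hX', eX⟩ := hX.exists_extension hW hx
  obtain ⟨Y', hY', eY⟩ := hY.exists_extension hW hx
  obtain ⟨σ', hσ', eσ⟩ := hσ.exists_extension hW hx
  rw [← curvature_eq_of_eventuallyEq hW h (hX'.mono (Set.subset_univ _)) hX
    (hY'.mono (Set.subset_univ _)) hY (hσ'.mono (Set.subset_univ _)) hσ hx eX eY eσ,
    hA X' Y' σ' (hX'.mono (Set.subset_univ _)) (hY'.mono (Set.subset_univ _))
    (hσ'.mono (Set.subset_univ _)) x (hWU hx), eX.self_of_nhds, eY.self_of_nhds, eσ.self_of_nhds]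

theorem IsRelativelyTorsionFreeOn.mono (ht : IsRelativelyTorsionFreeOn I U φ cov) (hW : IsOpen W)
    (hWU : W ⊆ U) (h : IsConnectionOn I F W cov) (hφ : SmoothBundleMapOn I F W φ) :
    IsRelativelyTorsionFreeOn I W φ cov := by
  intro X Y hX hY x hx
  obtain ⟨X', hX', eX⟩ := hX.exists_extension hW hx
  obtain ⟨Y', hY', eY⟩ := hY.exists_extension hW hx
  have key : ∀ {Z Z' : Π x : M, TangentSpace I x}, SmoothOn I E W Z → SmoothOn I E W Z' →
      (∀ᶠ y in 𝓝 x, Z' y = Z y) →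
      cov (fun y ↦ φ y (Z y)) x = cov (fun y ↦ φ y (Z' y)) x := by
    intro Z Z' hZ hZ' eZ
    exact h.congr_of_eventuallyEq hW (hφ.apply hZ) (hφ.apply hZ') hx
      (eZ.mono fun y hy ↦ by rw [hy])
  have hb : mlieBracket I X' Y' x = mlieBracket I X Y x :=
    Filter.EventuallyEq.mlieBracket_vectorField_eq eX eY
  have := ht X' Y' (hX'.mono (Set.subset_univ _)) (hY'.mono (Set.subset_univ _)) x (hWU hx)
  rwa [← key hX (hX'.mono (Set.subset_univ _)) eX, ← key hY (hY'.mono (Set.subset_univ _)) eY, hb,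
    eX.self_of_nhds, eY.self_of_nhds] at this

theorem CodazziOn.mono {A : Π x : M, TangentSpace I x →L[ℝ] V x →L[ℝ] ℝ}
    (hA : CodazziOn I F U cov A) (hW : IsOpen W) (hWU : W ⊆ U)
    (h : IsConnectionOn I F W cov) : CodazziOn I F W cov A := by
  intro X Y σ hX hY hσ x hx
  obtain ⟨X', hX', eX⟩ := hX.exists_extension hW hx
  obtain ⟨Y', hY', eY⟩ := hY.exists_extension hW hx
  obtain ⟨σ', hσ', eσ⟩ := hσ.exists_extension hW hx
  have hb : mlieBracket I X' Y' x = mlieBracket I X Y x :=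
    Filter.EventuallyEq.mlieBracket_vectorField_eq eX eY
  have key : ∀ {Z Z' : Π x : M, TangentSpace I x}, (∀ᶠ y in 𝓝 x, Z' y = Z y) →
      mvfderiv I (fun y ↦ A y (Z' y) (σ' y)) x = mvfderiv I (fun y ↦ A y (Z y) (σ y)) x := by
    intro Z Z' eZ
    refine mvfderiv_congr ?_
    filter_upwards [eZ, eσ] with y h1 h2
    rw [h1, h2]
  have := hA X' Y' σ' (hX'.mono (Set.subset_univ _)) (hY'.mono (Set.subset_univ _))
    (hσ'.mono (Set.subset_univ _)) x (hWU hx)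
  rwa [key eX, key eY, hb, h.congr_of_eventuallyEq hW (hσ'.mono (Set.subset_univ _)) hσ hx eσ,
    eX.self_of_nhds, eY.self_of_nhds, eσ.self_of_nhds] at this

end Mono

/-- The projective change of the connection `cov` by the dual section `ρ`. -/
noncomputable def projectiveChange (φ : Π x : M, TangentSpace I x →L[ℝ] V x)
    (ρ : Π x : M, V x →L[ℝ] ℝ) (cov : (Π x : M, V x) → (Π x : M, TangentSpace I x →L[ℝ] V x)) :
    (Π x : M, V x) → (Π x : M, TangentSpace I x →L[ℝ] V x) :=
  fun σ x ↦ cov σ x + ((ρ x).comp (φ x)).smulRight (σ x) + ρ x (σ x) • φ x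

variable {ρ : Π x : M, V x →L[ℝ] ℝ}

theorem projectiveChange_apply (σ : Π x : M, V x) (x : M) (v : TangentSpace I x) :
    projectiveChange φ ρ cov σ x v = cov σ x v + ρ x (φ x v) • σ x + ρ x (σ x) • φ x v := by
  simp [projectiveChange]

theorem mdifferentiableAt_of_contMDiffOn {G : Type*} [NormedAddCommGroup G] [NormedSpace ℝ G]
    (hU : IsOpen U) {f : M → G} (hf : ContMDiffOn I 𝓘(ℝ, G) ∞ f U) {x : M} (hx : x ∈ U) :
    MDifferentiableAt I 𝓘(ℝ, G) f x :=
  ((hf x hx).contMDiffAt (hU.mem_nhds hx)).mdifferentiableAt (by simp)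

theorem IsConnectionOn.projectiveChange (h : IsConnectionOn I F U cov)
    (hφ : SmoothBundleMapOn I F U φ) (hρ : SmoothDualSectionOn I F U ρ) :
    IsConnectionOn I F U (projectiveChange φ ρ cov) where
  covariant :=
    { add := by
        intro σ τ x hσ hτ hx
        ext v
        simp only [projectiveChange_apply, h.covariant.add hσ hτ hx, add_apply, Pi.add_apply,
          map_add]
        module
      leibniz := by
        intro σ g x hσ hg hx
        ext v
        simp only [projectiveChange_apply, h.covariant.leibniz hσ hg hx, add_apply,
          smul_apply, Pi.smul_apply', map_smul, ContinuousLinearMap.smulRight_apply, smul_eq_mul]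
        module }
  smooth := by
    intro W hW hWU σ hσ
    refine smoothBundleMapOn_of_apply hW fun W' hW' hW'o X hX ↦ ?_
    have hσ' := hσ.mono hW'
    have hρ' := hρ.mono (hW'.trans hWU)
    have hφX := (hφ.mono (hW'.trans hWU)).apply hX
    have h1 := h.smoothOn_apply hW'o (hW'.trans hWU) hσ' hX
    have h2 := ContMDiffOn.smul_section (hρ'.apply hφX) hσ'
    have h3 := ContMDiffOn.smul_section (hρ'.apply hσ') hφX
    refine ((h1.add_section h2).add_section h3).congr fun y hy ↦ ?_
    simp [projectiveChange_apply]

/-- Torsion-freeness is preserved by projective changes. -/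
theorem IsRelativelyTorsionFreeOn.projectiveChange (ht : IsRelativelyTorsionFreeOn I U φ cov) :
    IsRelativelyTorsionFreeOn I U φ (projectiveChange φ ρ cov) := by
  intro X Y hX hY x hx
  -- The added term `ρ(φX)φY + ρ(φY)φX` is symmetric in `X` and `Y`.
  rw [projectiveChange_apply, projectiveChange_apply, ← ht X Y hX hY x hx]
  module

/-- The curvature of a projective change of a relatively torsion-free connection. -/
theorem curvature_projectiveChange (hU : IsOpen U) (h : IsConnectionOn I F U cov)
    (hφ : SmoothBundleMapOn I F U φ) (ht : IsRelativelyTorsionFreeOn I U φ cov)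
    (hρ : SmoothDualSectionOn I F U ρ) {X Y : Π x : M, TangentSpace I x} {η : Π x : M, V x}
    (hX : SmoothOn I E U X) (hY : SmoothOn I E U Y) (hη : SmoothOn I F U η) {x : M} (hx : x ∈ U) :
    curvature I (projectiveChange φ ρ cov) X Y η x = curvature I cov X Y η x
      + (mvfderiv I (fun y ↦ ρ y (φ y (Y y))) x (X x)
        - mvfderiv I (fun y ↦ ρ y (φ y (X y))) x (Y x) - ρ x (φ x (mlieBracket I X Y x))) • η x
      + (mvfderiv I (fun y ↦ ρ y (η y)) x (X x) - ρ x (cov η x (X x))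
          - ρ x (φ x (X x)) * ρ x (η x)) • φ x (Y x)
      - (mvfderiv I (fun y ↦ ρ y (η y)) x (Y x) - ρ x (cov η x (Y x))
          - ρ x (φ x (Y x)) * ρ x (η x)) • φ x (X x) := by
  have key : ∀ {X Y : Π x : M, TangentSpace I x}, SmoothOn I E U X → SmoothOn I E U Y →
      cov (fun y ↦ projectiveChange φ ρ cov η y (Y y)) x (X x) =
        cov (fun y ↦ cov η y (Y y)) x (X x)
        + (ρ x (φ x (Y x)) • cov η x (X x)
          + mvfderiv I (fun y ↦ ρ y (φ y (Y y))) x (X x) • η x)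
        + (ρ x (η x) • cov (fun y ↦ φ y (Y y)) x (X x)
          + mvfderiv I (fun y ↦ ρ y (η y)) x (X x) • φ x (Y x)) := by
    intro X Y hX hY
    have hφY := hφ.apply hY
    have h1 := h.smoothOn_apply hU subset_rfl hη hY
    have hf := hρ.apply hφY
    have hg := hρ.apply hη
    have h2 : SmoothOn I F U ((fun y ↦ ρ y (φ y (Y y))) • η) := ContMDiffOn.smul_section hf hη
    have h3 : SmoothOn I F U ((fun y ↦ ρ y (η y)) • fun y ↦ φ y (Y y)) :=
      ContMDiffOn.smul_section hg hφY
    have h12 : SmoothOn I F U ((fun y ↦ cov η y (Y y)) + (fun y ↦ ρ y (φ y (Y y))) • η) :=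
      ContMDiffOn.add_section h1 h2
    have e : (fun y ↦ projectiveChange φ ρ cov η y (Y y)) =
        (fun y ↦ cov η y (Y y)) + (fun y ↦ ρ y (φ y (Y y))) • η
          + (fun y ↦ ρ y (η y)) • fun y ↦ φ y (Y y) := by
      ext y
      rw [projectiveChange_apply]
      rfl
    rw [e, h.covariant.add (h12.mdifferentiableAt hU hx) (h3.mdifferentiableAt hU hx) hx,
      h.covariant.add (h1.mdifferentiableAt hU hx) (h2.mdifferentiableAt hU hx) hx,
      h.covariant.leibniz (hη.mdifferentiableAt hU hx)
        (mdifferentiableAt_of_contMDiffOn hU hf hx) hx,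
      h.covariant.leibniz (hφY.mdifferentiableAt hU hx)
        (mdifferentiableAt_of_contMDiffOn hU hg hx) hx]
    simp
  -- Torsion-freeness turns `ρ(η)(∇_X φY - ∇_Y φX)` into `ρ(η) φ[X, Y]`, which cancels against the
  -- bracket term of the changed connection.
  have tf : cov (fun y ↦ φ y (Y y)) x (X x) = cov (fun y ↦ φ y (X y)) x (Y x)
      + φ x (mlieBracket I X Y x) := by
    have := ht X Y hX hY x hx
    rw [sub_sub, sub_eq_zero] at this
    exact this
  rw [curvature, projectiveChange_apply (x := x) (v := X x),
    projectiveChange_apply (x := x) (v := Y x), projectiveChange_apply (x := x), key hX hY,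
    key hY hX, curvature, tf]
  simp only [projectiveChange_apply, map_add, map_smul, smul_eq_mul]
  module

end Connections

end CoherentTangent

namespace CoherentTangent

/-! ### The tensor `B = ∇ρ - (ρ ∘ φ) ⊗ ρ` and its role in the curvature. -/

section ProjectivelyFlat

set_option linter.unusedSectionVars false

variable {E : Type*} [NormedAddCommGroup E] [NormedSpace ℝ E] [FiniteDimensional ℝ E]
  {H : Type*} [TopologicalSpace H] {I : ModelWithCorners ℝ E H}
  {M : Type*} [TopologicalSpace M] [ChartedSpace H M] [IsManifold I ∞ M]
  {F : Type*} [NormedAddCommGroup F] [NormedSpace ℝ F] [FiniteDimensional ℝ F]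
  {V : M → Type*} [TopologicalSpace (TotalSpace F V)] [∀ x, TopologicalSpace (V x)]
  [∀ x, AddCommGroup (V x)] [∀ x, Module ℝ (V x)]
  [∀ x, IsTopologicalAddGroup (V x)] [∀ x, ContinuousSMul ℝ (V x)]
  [FiberBundle F V] [VectorBundle ℝ F V] [ContMDiffVectorBundle ∞ F V I]
  {cov cov' : (Π x : M, V x) → (Π x : M, TangentSpace I x →L[ℝ] V x)}
  {φ : Π x : M, TangentSpace I x →L[ℝ] V x}
  {ρ : Π x : M, V x →L[ℝ] ℝ}
  {B : Π x : M, TangentSpace I x →L[ℝ] V x →L[ℝ] ℝ}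
  {U W : Set M}

/-- Every vector is the value of a global smooth section. -/
theorem exists_smoothOn_univ_eq [T2Space M] {x : M} (v : V x) :
    ∃ σ : Π x : M, V x, SmoothOn I F Set.univ σ ∧ σ x = v := by
  obtain ⟨τ, hτ, e⟩ := (smoothOn_extend (I := I) (F := F) v).exists_extension
    (trivializationAt F V x).open_baseSet (FiberBundle.mem_baseSet_trivializationAt' x)
  exact ⟨τ, hτ, by simpa using e.self_of_nhds⟩

variable (I F) in
/-- `B(X, η) = (∇_X ρ)(η) - ρ(φ(X)) ρ(η)` over `U`. -/
def IsSchoutenOn (U : Set M) (φ : Π x : M, TangentSpace I x →L[ℝ] V x)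
    (cov : (Π x : M, V x) → (Π x : M, TangentSpace I x →L[ℝ] V x)) (ρ : Π x : M, V x →L[ℝ] ℝ)
    (B : Π x : M, TangentSpace I x →L[ℝ] V x →L[ℝ] ℝ) : Prop :=
  ∀ W ⊆ U, IsOpen W → ∀ σ : Π x : M, V x, SmoothOn I F W σ → ∀ x ∈ W, ∀ v : TangentSpace I x,
    B x v (σ x) = mvfderiv I (fun y ↦ ρ y (σ y)) x v - ρ x (cov σ x v) - ρ x (φ x v) * ρ x (σ x)

/-- The Leibniz terms of `d(ρ(σ))` and `ρ(∇σ)` cancel, so the defining expression is linear over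
functions in `σ` and depends only on its value at the point. Smoothness is checked on smooth
arguments. -/
theorem exists_isSchoutenOn (hU : IsOpen U) (h : IsConnectionOn I F U cov)
    (hφ : SmoothBundleMapOn I F U φ) (hρ : SmoothDualSectionOn I F U ρ) :
    ∃ B : Π x : M, TangentSpace I x →L[ℝ] V x →L[ℝ] ℝ,
      SmoothTensorOn I F U B ∧ IsSchoutenOn I F U φ cov ρ B := by
  classical
  have : ContMDiffVectorBundle 1 F V I := .of_le (n := ∞) (by simp)
  let Φ : Π x : M, (Π x : M, V x) → TangentSpace I x →L[ℝ] ℝ := fun x σ ↦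
    mvfderiv I (fun y ↦ ρ y (σ y)) x - (ρ x).comp (cov σ x) - ρ x (σ x) • (ρ x).comp (φ x)
  have hd : ∀ x ∈ U, ∀ σ : Π x : M, V x,
      MDifferentiableAt I (I.prod 𝓘(ℝ, F)) (fun y ↦ TotalSpace.mk' F y (σ y)) x →
      MDifferentiableAt I 𝓘(ℝ, ℝ) (fun y ↦ ρ y (σ y)) x := by
    intro x hx σ hσ
    have h1 := SmoothOn.mdifferentiableAt (V := fun x : M ↦ V x →L[ℝ] ℝ) hU hρ hx
    have h2 := MDifferentiableAt.clm_bundle_apply (E₂ := fun _ : M ↦ ℝ) h1 hσ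
    exact (mdifferentiableAt_section I (F := ℝ) (E := fun _ : M ↦ ℝ) _).1 h2
  have hΦ : ∀ x ∈ U, TensorialAt I F (Φ x) x := by
    intro x hx
    constructor
    · intro f σ hf hσ
      ext v
      have e : (fun y ↦ ρ y ((f • σ) y)) = fun y ↦ f y * ρ y (σ y) := by
        ext y; simp
      simp only [Φ, e, mvfderiv_fun_mul hf (hd x hx σ hσ), h.covariant.leibniz hσ hf hx]
      simp
      ring
    · intro σ τ hσ hτ
      ext v
      have e : (fun y ↦ ρ y ((σ + τ) y)) = fun y ↦ ρ y (σ y) + ρ y (τ y) := by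
        ext y; simp
      simp only [Φ, e, mvfderiv_fun_add (hd x hx σ hσ) (hd x hx τ hτ), h.covariant.add hσ hτ hx]
      simp
      ring
  have hΦ₁ : ∀ x, ∀ σ : Π x : M, V x,
      TensorialAt I E (fun X : Π x : M, TangentSpace I x ↦ Φ x σ (X x)) x := fun x σ ↦
    ⟨fun _ _ ↦ by simp, fun _ _ ↦ by simp⟩
  have hΦ₂ : ∀ x ∈ U, ∀ X : Π x : M, TangentSpace I x,
      TensorialAt I F (fun σ ↦ Φ x σ (X x)) x := fun x hx X ↦
    ⟨fun hf hσ ↦ by simp [(hΦ x hx).smul hf hσ], fun hσ hτ ↦ by simp [(hΦ x hx).add hσ hτ]⟩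
  let B : Π x : M, TangentSpace I x →L[ℝ] V x →L[ℝ] ℝ := fun x ↦
    if hx : x ∈ U then
      TensorialAt.mkHom₂ (I := I) (F := E) (F' := F)
        (fun (X : Π x : M, TangentSpace I x) σ ↦ Φ x σ (X x)) x
        (fun σ _ ↦ hΦ₁ x σ) (fun X _ ↦ hΦ₂ x hx X)
    else 0
  have hB : IsSchoutenOn I F U φ cov ρ B := by
    intro W hWU hW σ hσ x hx v
    have := TensorialAt.mkHom₂_apply (I := I) (F := E) (F' := F)
      (Φ := fun (X : Π x : M, TangentSpace I x) σ ↦ Φ x σ (X x)) (x := x)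
      (fun σ _ ↦ hΦ₁ x σ) (fun X _ ↦ hΦ₂ x (hWU hx) X)
      (σ := FiberBundle.extend E v) (FiberBundle.mdifferentiableAt_extend I E v) (hσ.mdifferentiableAt hW hx)
    rw [FiberBundle.extend_apply_self] at this
    simp only [B, hWU hx, dif_pos, this]
    simp [Φ]
    ring
  refine ⟨B, smoothTensorOn_of_apply hU fun W hWU hW X σ hX hσ ↦ ?_, hB⟩
  have hρ' := hρ.mono hWU
  have hφX := (hφ.mono hWU).apply hX
  refine (((contMDiffOn_mvfderiv_apply hW (hρ'.apply hσ) hX).sub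
    (hρ'.apply (h.smoothOn_apply hW hWU hσ hX))).sub
    ((hρ'.apply hφX).mul (hρ'.apply hσ))).congr fun x hx ↦ ?_
  exact hB W hWU hW σ hσ x hx (X x)

/-- `cov'` is controlled only on sections smooth over `U`. It agrees there with the explicit
projective change, and since covariant derivatives of such sections are again smooth, the two
curvatures agree. -/
theorem ProjectivelyEquivalentOn.isFlatOn [T2Space M] (hU : IsOpen U)
    (h : IsConnectionOn I F U cov) (h' : IsConnectionOn I F U cov')
    (hφ : SmoothBundleMapOn I F U φ) (hρ : SmoothDualSectionOn I F U ρ)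
    (he : ∀ (X : Π x : M, TangentSpace I x) (η : Π x : M, V x),
      SmoothOn I E U X → SmoothOn I F U η → ∀ x ∈ U,
        cov' η x (X x) = cov η x (X x) + ρ x (φ x (X x)) • η x + ρ x (η x) • φ x (X x))
    (hf : IsFlatOn I F U cov') : IsFlatOn I F U (projectiveChange φ ρ cov) := by
  have e : ∀ η : Π x : M, V x, SmoothOn I F U η → ∀ x ∈ U,
      projectiveChange φ ρ cov η x = cov' η x := by
    intro η hη x hx
    ext v
    obtain ⟨X, hX, rfl⟩ := exists_smoothOn_univ_eq (I := I) (F := E) v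
    rw [projectiveChange_apply, he X η (hX.mono (Set.subset_univ _)) hη x hx]
  intro X Y η hX hY hη x hx
  have key : ∀ {Z : Π x : M, TangentSpace I x}, SmoothOn I E U Z →
      projectiveChange φ ρ cov (fun y ↦ projectiveChange φ ρ cov η y (Z y)) x =
        cov' (fun y ↦ cov' η y (Z y)) x := by
    intro Z hZ
    have h1 := h'.smoothOn_apply hU subset_rfl hη hZ
    rw [← e _ h1 x hx]
    refine (h.projectiveChange hφ hρ).congr_of_eventuallyEq hU
      ((h.projectiveChange hφ hρ).smoothOn_apply hU subset_rfl hη hZ) h1 hx ?_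
    filter_upwards [hU.mem_nhds hx] with y hy
    rw [e η hη y hy]
  rw [curvature, key hX, key hY, e η hη x hx]
  exact hf X Y η hX hY hη x hx

/-- Apply `ρ` to the torsion equation: the quadratic part of `B(X, φY)` is symmetric, so the
antisymmetric part is the exterior derivative of `ρ ∘ φ`. -/
theorem IsSchoutenOn.exterior_apply (hB : IsSchoutenOn I F U φ cov ρ B) (hU : IsOpen U)
    (hφ : SmoothBundleMapOn I F U φ) (ht : IsRelativelyTorsionFreeOn I U φ cov)
    {X Y : Π x : M, TangentSpace I x} (hX : SmoothOn I E U X) (hY : SmoothOn I E U Y) {x : M}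
    (hx : x ∈ U) :
    mvfderiv I (fun y ↦ ρ y (φ y (Y y))) x (X x) - mvfderiv I (fun y ↦ ρ y (φ y (X y))) x (Y x)
      - ρ x (φ x (mlieBracket I X Y x)) = B x (X x) (φ x (Y x)) - B x (Y x) (φ x (X x)) := by
  have h1 := congr(ρ x $(ht X Y hX hY x hx))
  rw [map_sub, map_sub, map_zero] at h1
  rw [hB U subset_rfl hU _ (hφ.apply hY) x hx, hB U subset_rfl hU _ (hφ.apply hX) x hx]
  linarith

/-- The curvature of a projective change in terms of the tensor `B`. -/
theorem IsSchoutenOn.curvature_projectiveChange (hB : IsSchoutenOn I F U φ cov ρ B)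
    (hU : IsOpen U) (h : IsConnectionOn I F U cov)
    (hφ : SmoothBundleMapOn I F U φ) (ht : IsRelativelyTorsionFreeOn I U φ cov)
    (hρ : SmoothDualSectionOn I F U ρ) {X Y : Π x : M, TangentSpace I x} {η : Π x : M, V x}
    (hX : SmoothOn I E U X) (hY : SmoothOn I E U Y) (hη : SmoothOn I F U η) {x : M} (hx : x ∈ U) :
    curvature I (projectiveChange φ ρ cov) X Y η x = curvature I cov X Y η x
      + (B x (X x) (φ x (Y x)) - B x (Y x) (φ x (X x))) • η x
      + B x (X x) (η x) • φ x (Y x) - B x (Y x) (η x) • φ x (X x) := by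
  rw [CoherentTangent.curvature_projectiveChange hU h hφ ht hρ hX hY hη hx,
    hB.exterior_apply hU hφ ht hX hY hx, hB U subset_rfl hU η hη x hx,
    hB U subset_rfl hU η hη x hx]

/-- If the curvature has the form `R(X, Y)η = B(Y, η) φ(X) - B(X, η) φ(Y)` where
`B` is the tensor of a dual section, then `B` is a Codazzi tensor. -/
theorem IsSchoutenOn.codazziOn (hB : IsSchoutenOn I F U φ cov ρ B)
    (hU : IsOpen U) (h : IsConnectionOn I F U cov)
    (hφ : SmoothBundleMapOn I F U φ) (ht : IsRelativelyTorsionFreeOn I U φ cov)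
    (hρ : SmoothDualSectionOn I F U ρ)
    (hs : ∀ x ∈ U, ∀ v w : TangentSpace I x, B x v (φ x w) = B x w (φ x v))
    (hR : ∀ (X Y : Π x : M, TangentSpace I x) (η : Π x : M, V x), SmoothOn I E U X →
      SmoothOn I E U Y → SmoothOn I F U η → ∀ x ∈ U,
      curvature I cov X Y η x = B x (Y x) (η x) • φ x (X x) - B x (X x) (η x) • φ x (Y x)) :
    CodazziOn I F U cov B := by
  intro X Y η hX hY hη x hx
  have key : ∀ {X Y : Π x : M, TangentSpace I x}, SmoothOn I E U X → SmoothOn I E U Y →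
      mvfderiv I (fun y ↦ B y (Y y) (η y)) x (X x) =
        mvfderiv I (fun y ↦ mvfderiv I (fun z ↦ ρ z (η z)) y (Y y)) x (X x)
        - mvfderiv I (fun y ↦ ρ y (cov η y (Y y))) x (X x)
        - (mvfderiv I (fun y ↦ ρ y (φ y (Y y))) x (X x) * ρ x (η x)
          + ρ x (φ x (Y x)) * mvfderiv I (fun y ↦ ρ y (η y)) x (X x)) := by
    intro X Y hX hY
    have h1 := mdifferentiableAt_of_contMDiffOn hU (contMDiffOn_mvfderiv_apply hU (hρ.apply hη) hY) hx
    have h2 := mdifferentiableAt_of_contMDiffOn hU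
      (hρ.apply (h.smoothOn_apply hU subset_rfl hη hY)) hx
    have h3 := mdifferentiableAt_of_contMDiffOn hU (hρ.apply (hφ.apply hY)) hx
    have h4 := mdifferentiableAt_of_contMDiffOn hU (hρ.apply hη) hx
    have e : (fun y ↦ B y (Y y) (η y)) =ᶠ[𝓝 x] fun y ↦
        mvfderiv I (fun z ↦ ρ z (η z)) y (Y y) - ρ y (cov η y (Y y))
          - ρ y (φ y (Y y)) * ρ y (η y) := by
      filter_upwards [hU.mem_nhds hx] with y hy
      exact hB U subset_rfl hU η hη y hy (Y y)
    have h12 : MDifferentiableAt I 𝓘(ℝ, ℝ)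
        (fun y ↦ mvfderiv I (fun z ↦ ρ z (η z)) y (Y y) - ρ y (cov η y (Y y))) x := h1.sub h2
    have h34 : MDifferentiableAt I 𝓘(ℝ, ℝ) (fun y ↦ ρ y (φ y (Y y)) * ρ y (η y)) x := h3.mul h4
    rw [mvfderiv_congr e, mvfderiv_fun_sub h12 h34, mvfderiv_fun_sub h1 h2,
      mvfderiv_fun_mul h3 h4]
    simp
    ring
  have b := hB U subset_rfl hU η hη x hx
  have bX := hB U subset_rfl hU _ (h.smoothOn_apply hU subset_rfl hη hX) x hx (Y x)
  have bY := hB U subset_rfl hU _ (h.smoothOn_apply hU subset_rfl hη hY) x hx (X x)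
  have hbr := mvfderiv_mlieBracket_apply hU (hρ.apply hη) hX hY hx
  have hd := hB.exterior_apply hU hφ ht hX hY hx
  have hρR := congr(ρ x $(hR X Y η hX hY hη x hx))
  rw [hs x hx (X x) (Y x), sub_self] at hd
  simp only [curvature, map_sub, map_smul, smul_eq_mul] at hρR
  rw [key hX hY, key hY hX, b (mlieBracket I X Y x), hbr, bX, bY]
  -- Second derivatives of `ρ(η)` combine to `-ρ(R(X, Y)η)`; the exterior derivative of `ρ ∘ φ`
  -- vanishes by symmetry; substituting `∇ρ = B + (ρ ∘ φ) ⊗ ρ` in the product-rule terms returns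
  -- `+ρ(R(X, Y)η)`.
  linear_combination -hρR - ρ x (η x) * hd - ρ x (φ x (X x)) * b (Y x) + ρ x (φ x (Y x)) * b (X x)

end ProjectivelyFlat

end CoherentTangent

namespace CoherentTangent

/-! ### From projective flatness to a Codazzi tensor. -/

section TraceFree

set_option linter.unusedSectionVars false

variable {E : Type*} [NormedAddCommGroup E] [NormedSpace ℝ E] [FiniteDimensional ℝ E]
  {H : Type*} [TopologicalSpace H] {I : ModelWithCorners ℝ E H}
  {M : Type*} [TopologicalSpace M] [T2Space M] [ChartedSpace H M] [IsManifold I ∞ M]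
  {F : Type*} [NormedAddCommGroup F] [NormedSpace ℝ F] [FiniteDimensional ℝ F]
  {V : M → Type*} [TopologicalSpace (TotalSpace F V)] [∀ x, TopologicalSpace (V x)]
  [∀ x, AddCommGroup (V x)] [∀ x, Module ℝ (V x)]
  [∀ x, IsTopologicalAddGroup (V x)] [∀ x, ContinuousSMul ℝ (V x)]
  [FiberBundle F V] [VectorBundle ℝ F V] [ContMDiffVectorBundle ∞ F V I]
  {cov : (Π x : M, V x) → (Π x : M, TangentSpace I x →L[ℝ] V x)}
  {φ : Π x : M, TangentSpace I x →L[ℝ] V x}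
  {B : Π x : M, TangentSpace I x →L[ℝ] V x →L[ℝ] ℝ}
  {U W : Set M}

/-- The curvature endomorphism is a multiple of the identity plus two rank-one maps, whose traces
are evaluations. Global test sections suffice, because they realize the germs of the extensions
defining the endomorphism. -/
theorem IsTraceFree.eq_zero {h : IsConnectionOn I F Set.univ cov} (htr : IsTraceFree h)
    {X Y : Π x : M, TangentSpace I x} (hX : SmoothOn I E Set.univ X)
    (hY : SmoothOn I E Set.univ Y) {x : M} {a : ℝ} {β γ : V x →L[ℝ] ℝ} {v w : V x}
    (hc : ∀ η : Π x : M, V x, SmoothOn I F Set.univ η →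
      curvature I cov X Y η x = a • η x + β (η x) • v - γ (η x) • w) :
    Module.finrank ℝ F * a + β v - γ w = 0 := by
  have := VectorBundle.finiteDimensional ℝ F V x
  have e : curvatureEnd h hX hY x = a • LinearMap.id + (β : V x →ₗ[ℝ] ℝ).smulRight v
      - (γ : V x →ₗ[ℝ] ℝ).smulRight w := by
    ext u
    have ho := (trivializationAt F V x).open_baseSet
    have hx := FiberBundle.mem_baseSet_trivializationAt' (F := F) (E := V) x
    obtain ⟨τ, hτ, eτ⟩ := (smoothOn_extend (I := I) (F := F) u).exists_extension ho hx
    have h1 := hc τ hτ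
    rw [eτ.self_of_nhds, FiberBundle.extend_apply_self, curvature_eq_of_eventuallyEq ho
      (h.mono (Set.subset_univ _)) (hX.mono (Set.subset_univ _)) (hX.mono (Set.subset_univ _))
      (hY.mono (Set.subset_univ _)) (hY.mono (Set.subset_univ _)) (hτ.mono (Set.subset_univ _))
      (smoothOn_extend u) hx (.of_forall fun _ ↦ rfl) (.of_forall fun _ ↦ rfl) eτ] at h1
    simpa [curvatureEnd] using h1
  have ht := htr X Y hX hY x
  rw [e, map_sub, map_add, map_smul, LinearMap.trace_id, LinearMap.trace_smulRight,
    LinearMap.trace_smulRight, VectorBundle.finrank_eq ℝ F V x] at ht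
  simp only [smul_eq_mul, ContinuousLinearMap.coe_coe] at ht
  linarith

theorem CodazziOn.const_smul (hB : CodazziOn I F U cov B) (hU : IsOpen U)
    (hs : SmoothTensorOn I F U B) (c : ℝ) : CodazziOn I F U cov (fun x ↦ c • B x) := by
  intro X Y η hX hY hη x hx
  have key : ∀ {Z : Π x : M, TangentSpace I x}, SmoothOn I E U Z → ∀ v : TangentSpace I x,
      mvfderiv I (fun y ↦ (c • B y) (Z y) (η y)) x v
        = c * mvfderiv I (fun y ↦ B y (Z y) (η y)) x v := fun hZ v ↦
    mvfderiv_clm_comp (c • ContinuousLinearMap.id ℝ ℝ)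
      (mdifferentiableAt_of_contMDiffOn hU (hs.apply hZ hη) hx) v
  rw [key hX, key hY]
  simp only [smul_apply, smul_eq_mul]
  linear_combination c * hB X Y η hX hY hη x hx

/-- A projectively flat connection with trace-free curvature admits a Codazzi tensor that determines
its curvature. -/
theorem IsProjectivelyFlat.exists_codazziOn {n : ℕ} (hn : n ≠ 1)
    (hcov : IsCoherentTangentBundle I F φ cov) (htr : IsTraceFree hcov.connection)
    (hpf : IsProjectivelyFlat I F φ cov) (p : M) :
    ∃ U : Set M, IsOpen U ∧ p ∈ U ∧ ∃ A : Π x : M, TangentSpace I x →L[ℝ] V x →L[ℝ] ℝ,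
      SmoothTensorOn I F U A ∧ CurvatureFormulaOn I F n U φ cov A ∧ CodazziOn I F U cov A := by
  obtain ⟨U, hU, hp, cov', h', -, hf, ρ, hρ, he⟩ := hpf p
  have h := hcov.connection.mono (Set.subset_univ U)
  have hφ := hcov.smooth_map.mono (Set.subset_univ U)
  have ht := hcov.torsionFree.mono hU (Set.subset_univ U) h hφ
  have hf' := ProjectivelyEquivalentOn.isFlatOn hU h h' hφ hρ he hf
  obtain ⟨B, hBs, hB⟩ := exists_isSchoutenOn hU h hφ hρ
  have hR : ∀ (X Y : Π x : M, TangentSpace I x) (η : Π x : M, V x), SmoothOn I E U X →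
      SmoothOn I E U Y → SmoothOn I F U η → ∀ x ∈ U, curvature I cov X Y η x =
        (B x (Y x) (φ x (X x)) - B x (X x) (φ x (Y x))) • η x
          + B x (Y x) (η x) • φ x (X x) - B x (X x) (η x) • φ x (Y x) := by
    intro X Y η hX hY hη x hx
    have := hB.curvature_projectiveChange hU h hφ ht hρ hX hY hη hx
    rw [hf' X Y η hX hY hη x hx] at this
    refine sub_eq_zero.1 (Eq.trans ?_ this.symm)
    module
  have hs : ∀ x ∈ U, ∀ v w : TangentSpace I x, B x v (φ x w) = B x w (φ x v) := by
    intro x hx v w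
    obtain ⟨X, hX, rfl⟩ := exists_smoothOn_univ_eq (I := I) (F := E) v
    obtain ⟨Y, hY, rfl⟩ := exists_smoothOn_univ_eq (I := I) (F := E) w
    have := htr.eq_zero hX hY fun η hη ↦ hR X Y η (hX.mono (Set.subset_univ _))
      (hY.mono (Set.subset_univ _)) (hη.mono (Set.subset_univ _)) x hx
    -- The identity part contributes the rank, and the two rank-one parts together contribute one
    -- more copy of the same difference.
    have h2 : ((Module.finrank ℝ F : ℝ) + 1) * (B x (Y x) (φ x (X x)) - B x (X x) (φ x (Y x))) = 0 := by
      linarith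
    rcases mul_eq_zero.1 h2 with h3 | h3
    · exact absurd h3 (by positivity)
    · linarith
  have hR' : ∀ (X Y : Π x : M, TangentSpace I x) (η : Π x : M, V x), SmoothOn I E U X →
      SmoothOn I E U Y → SmoothOn I F U η → ∀ x ∈ U, curvature I cov X Y η x =
        B x (Y x) (η x) • φ x (X x) - B x (X x) (η x) • φ x (Y x) := by
    intro X Y η hX hY hη x hx
    rw [hR X Y η hX hY hη x hx, hs x hx (Y x) (X x), sub_self, zero_smul, zero_add]
  -- The factor `n - 1` undoes the normalization in the curvature formula; it is invertible because
  -- `n ≠ 1`.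
  refine ⟨U, hU, hp, fun x ↦ ((n : ℝ) - 1) • B x, ?_, ?_, ?_⟩
  · refine smoothTensorOn_of_apply hU fun W hWU hW X σ hX hσ ↦ ?_
    exact contMDiffOn_const.mul ((hBs.mono hWU).apply hX hσ)
  · intro X Y η hX hY hη x hx
    have hn' : (n : ℝ) - 1 ≠ 0 := sub_ne_zero.2 (by exact_mod_cast hn)
    rw [hR' X Y η hX hY hη x hx]
    simp only [smul_apply, smul_eq_mul, smul_sub, smul_smul]
    rw [← mul_assoc, ← mul_assoc, one_div, inv_mul_cancel₀ hn', one_mul, one_mul]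
  · exact (hB.codazziOn hU h hφ ht hρ hs hR').const_smul hU hBs _

end TraceFree

end CoherentTangent

namespace CoherentTangent

/-! ### Algebra of the linearized system for `(μ, f)`. -/

section LinearSystem

variable {F : Type*} [NormedAddCommGroup F] [NormedSpace ℝ F] [FiniteDimensional ℝ F]

/-- The endomorphism `(μ, f) ↦ (μ ∘ Γ - f C, μ(m))` attached to `(Γ, C, m)`. -/
noncomputable def systemMap (T : (F →L[ℝ] F) × (F →L[ℝ] ℝ) × F) :
    ((F →L[ℝ] ℝ) × ℝ) →L[ℝ] ((F →L[ℝ] ℝ) × ℝ) :=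
  LinearMap.toContinuousLinearMap
    ({ toFun := fun g ↦ (g.1.comp T.1 - g.2 • T.2.1, g.1 T.2.2)
       map_add' := fun g h ↦ by
        refine Prod.ext (ContinuousLinearMap.ext fun w ↦ ?_) ?_ <;> simp
        ring
       map_smul' := fun c g ↦ by
        refine Prod.ext (ContinuousLinearMap.ext fun w ↦ ?_) ?_ <;> simp
        ring } : ((F →L[ℝ] ℝ) × ℝ) →ₗ[ℝ] ((F →L[ℝ] ℝ) × ℝ))

theorem systemMap_apply (T : (F →L[ℝ] F) × (F →L[ℝ] ℝ) × F) (g : (F →L[ℝ] ℝ) × ℝ) :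
    systemMap T g = (g.1.comp T.1 - g.2 • T.2.1, g.1 T.2.2) := rfl

/-- `systemMap` as a continuous linear map. -/
noncomputable def systemEnd (F : Type*) [NormedAddCommGroup F] [NormedSpace ℝ F]
    [FiniteDimensional ℝ F] : ((F →L[ℝ] F) × (F →L[ℝ] ℝ) × F) →L[ℝ]
      (((F →L[ℝ] ℝ) × ℝ) →L[ℝ] ((F →L[ℝ] ℝ) × ℝ)) where
  toFun := systemMap
  map_add' S T := by
    refine ContinuousLinearMap.ext fun g ↦
      Prod.ext (ContinuousLinearMap.ext fun w ↦ ?_) ?_ <;> simp [systemMap_apply]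
    ring
  map_smul' c T := by
    refine ContinuousLinearMap.ext fun g ↦
      Prod.ext (ContinuousLinearMap.ext fun w ↦ ?_) ?_ <;> simp [systemMap_apply]
    ring
  cont := by
    refine continuous_clm_apply.2 fun g ↦ ?_
    simp only [systemMap_apply]
    fun_prop

theorem systemEnd_apply (T : (F →L[ℝ] F) × (F →L[ℝ] ℝ) × F) (g : (F →L[ℝ] ℝ) × ℝ) :
    systemEnd F T g = (g.1.comp T.1 - g.2 • T.2.1, g.1 T.2.2) := rfl

theorem systemEnd_fst (T : (F →L[ℝ] F) × (F →L[ℝ] ℝ) × F) (g : (F →L[ℝ] ℝ) × ℝ) (w : F) :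
    (systemEnd F T g).1 w = g.1 (T.1 w) - g.2 * T.2.1 w := by
  simp [systemEnd_apply]

theorem systemEnd_snd (T : (F →L[ℝ] F) × (F →L[ℝ] ℝ) × F) (g : (F →L[ℝ] ℝ) × ℝ) :
    (systemEnd F T g).2 = g.1 T.2.2 := by
  simp [systemEnd_apply]

/-- With `S`, `T` the data along two coordinate fields and `R` their exterior derivative, `h1`, `h2`
and `h3` are the curvature, Codazzi and torsion equations in coordinates. The symmetry `hs` removes
the `f` term from the second component. -/
theorem systemEnd_eq_commutator {S T R : (F →L[ℝ] F) × (F →L[ℝ] ℝ) × F}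
    (h1 : ∀ w, R.1 w = T.1 (S.1 w) - S.1 (T.1 w) + T.2.1 w • S.2.2 - S.2.1 w • T.2.2)
    (h2 : ∀ w, R.2.1 w = T.2.1 (S.1 w) - S.2.1 (T.1 w))
    (h3 : R.2.2 = T.1 S.2.2 - S.1 T.2.2) (hs : S.2.1 T.2.2 = T.2.1 S.2.2) :
    systemEnd F R = systemEnd F S * systemEnd F T - systemEnd F T * systemEnd F S := by
  refine ContinuousLinearMap.ext fun g ↦ Prod.ext (ContinuousLinearMap.ext fun w ↦ ?_) ?_
  · simp only [sub_apply, mul_apply_eq_comp, Prod.fst_sub, systemEnd_fst, systemEnd_snd,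
      h1, h2, map_add, map_sub, map_smul, smul_eq_mul]
    ring
  · simp only [sub_apply, mul_apply_eq_comp, Prod.snd_sub, systemEnd_fst, systemEnd_snd,
      h3, map_sub, hs]
    ring

end LinearSystem

/-! ### The connection form in a trivialization. -/

section Existence

set_option linter.unusedSectionVars false

theorem mvfderiv_clm_apply {E : Type*} [NormedAddCommGroup E] [NormedSpace ℝ E]
    {H : Type*} [TopologicalSpace H] {I : ModelWithCorners ℝ E H}
    {M : Type*} [TopologicalSpace M] [ChartedSpace H M]
    {F F' : Type*} [NormedAddCommGroup F] [NormedSpace ℝ F]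
    [NormedAddCommGroup F'] [NormedSpace ℝ F'] {g : M → F →L[ℝ] F'} {f : M → F} {x : M}
    (hg : MDifferentiableAt I 𝓘(ℝ, F →L[ℝ] F') g x) (hf : MDifferentiableAt I 𝓘(ℝ, F) f x)
    (v : TangentSpace I x) :
    mvfderiv I (fun y ↦ g y (f y)) x v = mvfderiv I g x v (f x) + g x (mvfderiv I f x v) := by
  let G : E →L[ℝ] F →L[ℝ] F' := mvfderiv I g x
  let A : E →L[ℝ] F := mvfderiv I f x
  let D : E →L[ℝ] F' := (g x).comp A + G.flip (f x)
  have h : HasMFDerivAt I 𝓘(ℝ, F') (fun y ↦ g y (f y)) x D := by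
    refine ⟨hg.continuousAt.clm_apply hf.continuousAt, ?_⟩
    have := hg.hasMFDerivAt.2.clm_apply hf.hasMFDerivAt.2
    simp only [writtenInExtChartAt, Function.comp_apply, chartAt_self_eq, mfld_simps] at this ⊢
    exact this
  have := congr($(h.mfderiv) v)
  exact this.trans (add_comm (g x (A v)) (G v (f x)))

variable {E : Type*} [NormedAddCommGroup E] [NormedSpace ℝ E] [FiniteDimensional ℝ E]
  {H : Type*} [TopologicalSpace H] {I : ModelWithCorners ℝ E H}
  {M : Type*} [TopologicalSpace M] [ChartedSpace H M] [IsManifold I ∞ M]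
  {F : Type*} [NormedAddCommGroup F] [NormedSpace ℝ F] [FiniteDimensional ℝ F]
  {V : M → Type*} [TopologicalSpace (TotalSpace F V)] [∀ x, TopologicalSpace (V x)]
  [∀ x, AddCommGroup (V x)] [∀ x, Module ℝ (V x)]
  [∀ x, IsTopologicalAddGroup (V x)] [∀ x, ContinuousSMul ℝ (V x)]
  [FiberBundle F V] [VectorBundle ℝ F V] [ContMDiffVectorBundle ∞ F V I]
  {cov : (Π x : M, V x) → (Π x : M, TangentSpace I x →L[ℝ] V x)}
  {φ : Π x : M, TangentSpace I x →L[ℝ] V x}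
  {C : Π x : M, TangentSpace I x →L[ℝ] V x →L[ℝ] ℝ}
  {U W : Set M}

variable (I F) in
/-- `Γ` is the connection form of `cov` over `U` in the trivialization at `p`. -/
def IsConnectionFormOn (p : M) (U : Set M)
    (cov : (Π x : M, V x) → (Π x : M, TangentSpace I x →L[ℝ] V x))
    (Γ : Π x : M, TangentSpace I x →L[ℝ] V x →L[ℝ] F) : Prop :=
  ∀ W ⊆ U, IsOpen W → ∀ σ : Π x : M, V x, SmoothOn I F W σ → ∀ x ∈ W, ∀ v : TangentSpace I x,
    coord F V p x (cov σ x v) = mvfderiv I (fun y ↦ coord F V p y (σ y)) x v + Γ x v (σ x)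

/-- The covariant derivative and the derivative of coordinates obey the same Leibniz rule, so their
difference is tensorial. -/
theorem exists_isConnectionFormOn {p : M} (hU : IsOpen U)
    (hUp : U ⊆ (trivializationAt F V p).baseSet) (h : IsConnectionOn I F U cov) :
    ∃ Γ : Π x : M, TangentSpace I x →L[ℝ] V x →L[ℝ] F, IsConnectionFormOn I F p U cov Γ := by
  classical
  have : ContMDiffVectorBundle 1 F V I := .of_le (n := ∞) (by simp)
  let Φ : Π x : M, (Π x : M, V x) → TangentSpace I x →L[ℝ] F := fun x σ ↦
    (coord F V p x).comp (cov σ x) - mvfderiv I (fun y ↦ coord F V p y (σ y)) x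
  have hd : ∀ x ∈ U, ∀ σ : Π x : M, V x,
      MDifferentiableAt I (I.prod 𝓘(ℝ, F)) (fun y ↦ TotalSpace.mk' F y (σ y)) x →
      MDifferentiableAt I 𝓘(ℝ, F) (fun y ↦ coord F V p y (σ y)) x := by
    intro x hx σ hσ
    refine (((trivializationAt F V p).mdifferentiableAt_section_iff I σ (hUp hx)).1
      hσ).congr_of_eventuallyEq ?_
    filter_upwards [hU.mem_nhds hx] with y hy
    exact coord_apply (hUp hy) _
  have hΦ : ∀ x ∈ U, TensorialAt I F (Φ x) x := by
    intro x hx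
    constructor
    · intro f σ hf hσ
      ext v
      have e : (fun y ↦ coord F V p y ((f • σ) y)) = fun y ↦ f y • coord F V p y (σ y) := by
        ext y; simp
      simp only [Φ, e, mvfderiv_fun_smul hf (hd x hx σ hσ), h.covariant.leibniz hσ hf hx]
      simp
      module
    · intro σ τ hσ hτ
      ext v
      have e : (fun y ↦ coord F V p y ((σ + τ) y)) =
          fun y ↦ coord F V p y (σ y) + coord F V p y (τ y) := by
        ext y; simp
      simp only [Φ, e, mvfderiv_fun_add (hd x hx σ hσ) (hd x hx τ hτ), h.covariant.add hσ hτ hx]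
      simp
      module
  have hΦ₁ : ∀ x, ∀ σ : Π x : M, V x,
      TensorialAt I E (fun X : Π x : M, TangentSpace I x ↦ Φ x σ (X x)) x := fun x σ ↦
    ⟨fun _ _ ↦ by simp, fun _ _ ↦ by simp⟩
  have hΦ₂ : ∀ x ∈ U, ∀ X : Π x : M, TangentSpace I x,
      TensorialAt I F (fun σ ↦ Φ x σ (X x)) x := fun x hx X ↦
    ⟨fun hf hσ ↦ by simp [(hΦ x hx).smul hf hσ], fun hσ hτ ↦ by simp [(hΦ x hx).add hσ hτ]⟩
  refine ⟨fun x ↦ if hx : x ∈ U then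
      TensorialAt.mkHom₂ (I := I) (F := E) (F' := F)
        (fun (X : Π x : M, TangentSpace I x) σ ↦ Φ x σ (X x)) x
        (fun σ _ ↦ hΦ₁ x σ) (fun X _ ↦ hΦ₂ x hx X)
    else 0, fun W hWU hW σ hσ x hx v ↦ ?_⟩
  have := TensorialAt.mkHom₂_apply (I := I) (F := E) (F' := F)
    (Φ := fun (X : Π x : M, TangentSpace I x) σ ↦ Φ x σ (X x)) (x := x)
    (fun σ _ ↦ hΦ₁ x σ) (fun X _ ↦ hΦ₂ x (hWU hx) X)
    (σ := FiberBundle.extend E v) (FiberBundle.mdifferentiableAt_extend I E v)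
    (hσ.mdifferentiableAt hW hx)
  rw [FiberBundle.extend_apply_self] at this
  simp only [hWU hx, dif_pos, this]
  simp [Φ]

theorem IsConnectionFormOn.coord_cov_constSection {p : M}
    {Γ : Π x : M, TangentSpace I x →L[ℝ] V x →L[ℝ] F}
    (hΓ : IsConnectionFormOn I F p U cov Γ) (hU : IsOpen U)
    (hUp : U ⊆ (trivializationAt F V p).baseSet) (w : F) {x : M} (hx : x ∈ U)
    (v : TangentSpace I x) :
    coord F V p x (cov (constSection F V p w) x v) = Γ x v (constSection F V p w x) := by
  have e : (fun y ↦ coord F V p y (constSection F V p w y)) =ᶠ[𝓝 x] fun _ ↦ w := by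
    filter_upwards [hU.mem_nhds hx] with y hy
    exact coord_constSection (hUp hy) w
  rw [hΓ U subset_rfl hU _ ((smoothOn_constSection p w).mono hUp) x hx, mvfderiv_congr e,
    mvfderiv_const]
  simp

/-- The data `(Γ, C, φ)` in the trivialization at `p`. -/
noncomputable def coordData (p : M) (Γ : Π x : M, TangentSpace I x →L[ℝ] V x →L[ℝ] F)
    (C : Π x : M, TangentSpace I x →L[ℝ] V x →L[ℝ] ℝ)
    (φ : Π x : M, TangentSpace I x →L[ℝ] V x) (x : M) :
    TangentSpace I x →L[ℝ] (F →L[ℝ] F) × (F →L[ℝ] ℝ) × F :=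
  ((((trivializationAt F V p).symmL ℝ x).precomp F).comp (Γ x)).prod
    (((((trivializationAt F V p).symmL ℝ x).precomp ℝ).comp (C x)).prod
      ((coord F V p x).comp (φ x)))

end Existence

end CoherentTangent

namespace CoherentTangent

/-! ### Componentwise derivatives and vector-valued linear systems. -/

section Derivatives

set_option linter.unusedSectionVars false

variable {E : Type*} [NormedAddCommGroup E] [NormedSpace ℝ E] [FiniteDimensional ℝ E]
  {H : Type*} [TopologicalSpace H] {I : ModelWithCorners ℝ E H}
  {M : Type*} [TopologicalSpace M] [ChartedSpace H M] [IsManifold I ∞ M]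
  {A B : Type*} [NormedAddCommGroup A] [NormedSpace ℝ A] [NormedAddCommGroup B] [NormedSpace ℝ B]

theorem mvfderiv_fst_eq {T : M → A × B} {x : M} (hT : MDifferentiableAt I 𝓘(ℝ, A × B) T x)
    (v : TangentSpace I x) : (mvfderiv I T x v).1 = mvfderiv I (fun y ↦ (T y).1) x v :=
  (mvfderiv_clm_comp (ContinuousLinearMap.fst ℝ A B) hT v).symm

theorem mvfderiv_snd_eq {T : M → A × B} {x : M} (hT : MDifferentiableAt I 𝓘(ℝ, A × B) T x)
    (v : TangentSpace I x) : (mvfderiv I T x v).2 = mvfderiv I (fun y ↦ (T y).2) x v :=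
  (mvfderiv_clm_comp (ContinuousLinearMap.snd ℝ A B) hT v).symm

theorem mvfderiv_apply_eq {T : M → A →L[ℝ] B} {x : M}
    (hT : MDifferentiableAt I 𝓘(ℝ, A →L[ℝ] B) T x) (v : TangentSpace I x) (w : A) :
    mvfderiv I T x v w = mvfderiv I (fun y ↦ T y w) x v :=
  (mvfderiv_clm_comp (ContinuousLinearMap.apply ℝ B w) hT v).symm

theorem mdifferentiableAt_clm_comp (ℓ : A →L[ℝ] B) {T : M → A} {x : M}
    (hT : MDifferentiableAt I 𝓘(ℝ, A) T x) :
    MDifferentiableAt I 𝓘(ℝ, B) (fun y ↦ ℓ (T y)) x :=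
  (ℓ.mdifferentiableAt (x := T x)).comp x hT

/-- Frobenius theorem for vector-valued linear systems whose coefficients depend linearly on given
data. -/
theorem exists_mvfderiv_eq_apply_of_flat
    [I.Boundaryless] [CompleteSpace B] {p : M} {U : Set M} (hU : IsOpen U)
    (hp : p ∈ U) (hUp : U ⊆ (trivializationAt E (TangentSpace I) p).baseSet)
    (J : A →L[ℝ] B →L[ℝ] B) (T : Π x : M, TangentSpace I x →L[ℝ] A)
    (hT : ∀ a, ContMDiffOn I 𝓘(ℝ, A) ∞ (fun x ↦ T x (constSection E (TangentSpace I) p a x)) U)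
    (hflat : ∀ x ∈ U, ∀ a b : E,
      J (mvfderiv I (fun y ↦ T y (constSection E (TangentSpace I) p b y)) x
          (constSection E (TangentSpace I) p a x)
        - mvfderiv I (fun y ↦ T y (constSection E (TangentSpace I) p a y)) x
          (constSection E (TangentSpace I) p b x)) =
      J (T x (constSection E (TangentSpace I) p a x)) * J (T x (constSection E (TangentSpace I) p b x))
        - J (T x (constSection E (TangentSpace I) p b x))
          * J (T x (constSection E (TangentSpace I) p a x))) (g₀ : B) :
    ∃ W : Set M, IsOpen W ∧ p ∈ W ∧ W ⊆ U ∧ ∃ g : M → B, g p = g₀ ∧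
      ContMDiffOn I 𝓘(ℝ, B) ∞ g W ∧ ∀ x ∈ W, ∀ X : TangentSpace I x,
        mvfderiv I g x X = J (T x X) (g x) := by
  -- The fundamental solution is found in the algebra of endomorphisms of `B` and then applied to
  -- `g₀`.
  obtain ⟨W, hW, hpW, hWU, u, hu1, hus, hu⟩ := exists_mvfderiv_eq_of_flat (L := B →L[ℝ] B) hU hp hUp
    (fun x ↦ J.comp (T x))
    (fun a ↦ J.contMDiff.comp_contMDiffOn (hT a))
    (fun x hx a b ↦ by
      have hd := fun a ↦ ((hT a x hx).contMDiffAt (hU.mem_nhds hx)).mdifferentiableAt (by simp)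
      have e := hflat x hx a b
      rw [map_sub, ← mvfderiv_clm_comp J (hd b), ← mvfderiv_clm_comp J (hd a)] at e
      exact e)
  refine ⟨W, hW, hpW, hWU, fun x ↦ u x g₀, by simp [hu1], ?_, fun x hx X ↦ ?_⟩
  · exact (ContinuousLinearMap.apply ℝ B g₀).contMDiff.comp_contMDiffOn hus
  · rw [← mvfderiv_apply_eq (((hus x hx).contMDiffAt (hW.mem_nhds hx)).mdifferentiableAt (by simp)),
      hu x hx X]
    rfl

end Derivatives

/-! ### Solving `∇ρ = C + (ρ ∘ φ) ⊗ ρ`. -/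

section Existence

set_option linter.unusedSectionVars false

variable {E : Type*} [NormedAddCommGroup E] [NormedSpace ℝ E] [FiniteDimensional ℝ E]
  {H : Type*} [TopologicalSpace H] {I : ModelWithCorners ℝ E H}
  {M : Type*} [TopologicalSpace M] [ChartedSpace H M] [IsManifold I ∞ M]
  {F : Type*} [NormedAddCommGroup F] [NormedSpace ℝ F] [FiniteDimensional ℝ F]
  {V : M → Type*} [TopologicalSpace (TotalSpace F V)] [∀ x, TopologicalSpace (V x)]
  [∀ x, AddCommGroup (V x)] [∀ x, Module ℝ (V x)]
  [∀ x, IsTopologicalAddGroup (V x)] [∀ x, ContinuousSMul ℝ (V x)]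
  [FiberBundle F V] [VectorBundle ℝ F V] [ContMDiffVectorBundle ∞ F V I]
  {cov : (Π x : M, V x) → (Π x : M, TangentSpace I x →L[ℝ] V x)}
  {φ : Π x : M, TangentSpace I x →L[ℝ] V x}
  {C : Π x : M, TangentSpace I x →L[ℝ] V x →L[ℝ] ℝ}
  {Γ : Π x : M, TangentSpace I x →L[ℝ] V x →L[ℝ] F} {p : M}
  {U W : Set M}

theorem coordData_fst (x : M) (v : TangentSpace I x) (w : F) :
    (coordData p Γ C φ x v).1 w = Γ x v (constSection F V p w x) := rfl

theorem coordData_snd_fst (x : M) (v : TangentSpace I x) (w : F) :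
    (coordData p Γ C φ x v).2.1 w = C x v (constSection F V p w x) := rfl

theorem coordData_snd_snd (x : M) (v : TangentSpace I x) :
    (coordData p Γ C φ x v).2.2 = coord F V p x (φ x v) := rfl

/-- Smoothness of `Γ` is not part of its definition: its values on the constant frame are
coordinates of covariant derivatives of smooth sections. -/
theorem IsConnectionFormOn.contMDiffOn_coordData (hΓ : IsConnectionFormOn I F p U cov Γ)
    (hU : IsOpen U) (hUp : U ⊆ (trivializationAt F V p).baseSet) (h : IsConnectionOn I F U cov)
    (hφ : SmoothBundleMapOn I F U φ) (hC : SmoothTensorOn I F U C)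
    {X : Π x : M, TangentSpace I x} (hX : SmoothOn I E U X) :
    ContMDiffOn I 𝓘(ℝ, (F →L[ℝ] F) × (F →L[ℝ] ℝ) × F) ∞
      (fun x ↦ coordData p Γ C φ x (X x)) U := by
  have he : ∀ w, SmoothOn I F U (constSection F V p w) := fun w ↦
    (smoothOn_constSection p w).mono hUp
  refine ContMDiffOn.prodMk_space (contMDiffOn_clm_of_apply fun w ↦ ?_)
    (ContMDiffOn.prodMk_space (contMDiffOn_clm_of_apply fun w ↦ ?_) ?_)
  · refine ((smoothOn_iff_coord hU hUp).1
      (h.smoothOn_apply hU subset_rfl (he w) hX)).congr fun x hx ↦ ?_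
    exact (hΓ.coord_cov_constSection hU hUp w hx (X x)).symm
  · exact hC.apply hX (he w)
  · exact (smoothOn_iff_coord hU hUp).1 (hφ.apply hX)

/-- The structure equations of the data `(Γ, C, φ)`. -/
theorem IsConnectionFormOn.systemEnd_flat (hΓ : IsConnectionFormOn I F p U cov Γ)
    (hU : IsOpen U) (hUp : U ⊆ (trivializationAt F V p).baseSet)
    (hUp' : U ⊆ (trivializationAt E (TangentSpace I) p).baseSet) (h : IsConnectionOn I F U cov)
    (hφ : SmoothBundleMapOn I F U φ) (ht : IsRelativelyTorsionFreeOn I U φ cov)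
    (hC : SmoothTensorOn I F U C)
    (hs : ∀ x ∈ U, ∀ v w : TangentSpace I x, C x v (φ x w) = C x w (φ x v))
    (hR : ∀ (X Y : Π x : M, TangentSpace I x) (η : Π x : M, V x), SmoothOn I E U X →
      SmoothOn I E U Y → SmoothOn I F U η → ∀ x ∈ U,
      curvature I cov X Y η x = C x (Y x) (η x) • φ x (X x) - C x (X x) (η x) • φ x (Y x))
    (hcod : CodazziOn I F U cov C) {x : M} (hx : x ∈ U) (a b : E) :
    systemEnd F (mvfderiv I (fun y ↦ coordData p Γ C φ y (constSection E (TangentSpace I) p b y)) x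
          (constSection E (TangentSpace I) p a x)
        - mvfderiv I (fun y ↦ coordData p Γ C φ y (constSection E (TangentSpace I) p a y)) x
          (constSection E (TangentSpace I) p b x)) =
      systemEnd F (coordData p Γ C φ x (constSection E (TangentSpace I) p a x))
          * systemEnd F (coordData p Γ C φ x (constSection E (TangentSpace I) p b x))
        - systemEnd F (coordData p Γ C φ x (constSection E (TangentSpace I) p b x))
          * systemEnd F (coordData p Γ C φ x (constSection E (TangentSpace I) p a x)) := by
  have hX : ∀ a, SmoothOn I E U (constSection E (TangentSpace I) p a) := fun a ↦
    (smoothOn_constSection p a).mono hUp'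
  have he : ∀ w, SmoothOn I F U (constSection F V p w) := fun w ↦
    (smoothOn_constSection p w).mono hUp
  have hd : ∀ a, MDifferentiableAt I 𝓘(ℝ, (F →L[ℝ] F) × (F →L[ℝ] ℝ) × F)
      (fun y ↦ coordData p Γ C φ y (constSection E (TangentSpace I) p a y)) x := fun a ↦
    mdifferentiableAt_of_contMDiffOn hU (hΓ.contMDiffOn_coordData hU hUp h hφ hC (hX a)) hx
  -- Coordinate fields commute, which removes the bracket terms from all structure equations.
  have hbr : mlieBracket I (constSection E (TangentSpace I) p a)
      (constSection E (TangentSpace I) p b) x = 0 := mlieBracket_constSection (hUp' hx) a b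
  have hd1 := fun a ↦ mdifferentiableAt_clm_comp (ContinuousLinearMap.fst ℝ (F →L[ℝ] F) ((F →L[ℝ] ℝ) × F)) (hd a)
  have hd2 := fun a ↦ mdifferentiableAt_clm_comp (ContinuousLinearMap.snd ℝ (F →L[ℝ] F) ((F →L[ℝ] ℝ) × F)) (hd a)
  have hd3 := fun a ↦ mdifferentiableAt_clm_comp (ContinuousLinearMap.fst ℝ (F →L[ℝ] ℝ) F) (hd2 a)
  have d1 : ∀ (a : E) (v : TangentSpace I x) (w : F),
      (mvfderiv I (fun y ↦ coordData p Γ C φ y (constSection E (TangentSpace I) p a y)) x v).1 w =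
        mvfderiv I (fun y ↦ Γ y (constSection E (TangentSpace I) p a y)
          (constSection F V p w y)) x v := fun a v w ↦ by
    rw [mvfderiv_fst_eq (hd a)]
    exact mvfderiv_apply_eq (hd1 a) v w
  have d2 : ∀ (a : E) (v : TangentSpace I x) (w : F),
      (mvfderiv I (fun y ↦ coordData p Γ C φ y (constSection E (TangentSpace I) p a y)) x v).2.1 w =
        mvfderiv I (fun y ↦ C y (constSection E (TangentSpace I) p a y)
          (constSection F V p w y)) x v := fun a v w ↦ by
    rw [mvfderiv_snd_eq (hd a)]
    exact congr($(mvfderiv_fst_eq (hd2 a) v) w).trans (mvfderiv_apply_eq (hd3 a) v w)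
  have d3 : ∀ (a : E) (v : TangentSpace I x),
      (mvfderiv I (fun y ↦ coordData p Γ C φ y (constSection E (TangentSpace I) p a y)) x v).2.2 =
        mvfderiv I (fun y ↦ coord F V p y (φ y (constSection E (TangentSpace I) p a y))) x v :=
    fun a v ↦ by
    rw [mvfderiv_snd_eq (hd a)]
    exact mvfderiv_snd_eq (hd2 a) v
  have c : ∀ v : V x, constSection F V p (coord F V p x v) x = v :=
    fun v ↦ constSection_coord (hUp hx) v
  have cΓ : ∀ (w : F) (v : TangentSpace I x),
      constSection F V p (Γ x v (constSection F V p w x)) x = cov (constSection F V p w) x v := by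
    intro w v
    rw [← hΓ.coord_cov_constSection hU hUp w hx v, c]
  -- The four goals are, in order, the curvature formula, the Codazzi equation, the torsion equation
  -- and the symmetry of `C`.
  refine systemEnd_eq_commutator (fun w ↦ ?_) (fun w ↦ ?_) ?_ ?_
  · have key : ∀ (a : E) (v : TangentSpace I x), coord F V p x (cov (fun y ↦
        cov (constSection F V p w) y (constSection E (TangentSpace I) p a y)) x v) =
        mvfderiv I (fun y ↦ Γ y (constSection E (TangentSpace I) p a y)
          (constSection F V p w y)) x v
        + Γ x v (cov (constSection F V p w) x (constSection E (TangentSpace I) p a x)) := by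
      intro a v
      rw [hΓ U subset_rfl hU _ (h.smoothOn_apply hU subset_rfl (he w) (hX a)) x hx]
      congr 2
      refine mvfderiv_congr ?_
      filter_upwards [hU.mem_nhds hx] with y hy
      exact hΓ.coord_cov_constSection hU hUp w hy _
    have h1 := congr(coord F V p x $(hR _ _ _ (hX a) (hX b) (he w) x hx))
    rw [curvature, hbr, map_zero, sub_zero, map_sub, key, key] at h1
    simp only [Prod.fst_sub, sub_apply, d1, coordData_fst, coordData_snd_fst, coordData_snd_snd, cΓ]
    simp only [map_sub, map_smul] at h1
    rw [← sub_eq_zero] at h1 ⊢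
    rw [← h1]
    module
  · have h1 := hcod _ _ _ (hX a) (hX b) (he w) x hx
    rw [hbr, map_zero] at h1
    simp only [Prod.fst_sub, Prod.snd_sub, sub_apply, d2, coordData_fst, coordData_snd_fst, cΓ]
    simpa using h1
  · have h1 := congr(coord F V p x $(ht _ _ (hX a) (hX b) x hx))
    rw [hbr, map_zero, sub_zero, map_sub, map_zero,
      hΓ U subset_rfl hU _ (hφ.apply (hX b)) x hx,
      hΓ U subset_rfl hU _ (hφ.apply (hX a)) x hx] at h1
    simp only [Prod.snd_sub, d3, coordData_fst, coordData_snd_snd, c]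
    rw [← sub_eq_zero] at h1 ⊢
    rw [← h1]
    module
  · simp only [coordData_snd_fst, coordData_snd_snd, c]
    exact hs x hx _ _

/-- If the curvature is determined by a Codazzi tensor `C`, then `C` is the tensor of a dual
section `ρ`, i.e. the equation `∇ρ = C + (ρ ∘ φ) ⊗ ρ` is solvable. -/
theorem exists_isSchoutenOn_of_codazziOn [I.Boundaryless] (hU : IsOpen U) (hp : p ∈ U)
    (hUp : U ⊆ (trivializationAt F V p).baseSet)
    (hUp' : U ⊆ (trivializationAt E (TangentSpace I) p).baseSet) (h : IsConnectionOn I F U cov)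
    (hφ : SmoothBundleMapOn I F U φ) (ht : IsRelativelyTorsionFreeOn I U φ cov)
    (hC : SmoothTensorOn I F U C)
    (hs : ∀ x ∈ U, ∀ v w : TangentSpace I x, C x v (φ x w) = C x w (φ x v))
    (hR : ∀ (X Y : Π x : M, TangentSpace I x) (η : Π x : M, V x), SmoothOn I E U X →
      SmoothOn I E U Y → SmoothOn I F U η → ∀ x ∈ U,
      curvature I cov X Y η x = C x (Y x) (η x) • φ x (X x) - C x (X x) (η x) • φ x (Y x))
    (hcod : CodazziOn I F U cov C) :
    ∃ W : Set M, IsOpen W ∧ p ∈ W ∧ W ⊆ U ∧ ∃ ρ : Π x : M, V x →L[ℝ] ℝ,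
      SmoothDualSectionOn I F W ρ ∧ IsSchoutenOn I F W φ cov ρ C := by
  obtain ⟨Γ, hΓ⟩ := exists_isConnectionFormOn hU hUp h
  have hT : ∀ a, ContMDiffOn I 𝓘(ℝ, (F →L[ℝ] F) × (F →L[ℝ] ℝ) × F) ∞
      (fun y ↦ coordData p Γ C φ y (constSection E (TangentSpace I) p a y)) U := fun a ↦
    hΓ.contMDiffOn_coordData hU hUp h hφ hC ((smoothOn_constSection p a).mono hUp')
  -- Only `f p ≠ 0` matters in the initial value `(0, 1)`; the choice `μ p = 0` gives `ρ p = 0`.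
  obtain ⟨W, hW, hpW, hWU, g, hg1, hgs, hg⟩ := exists_mvfderiv_eq_apply_of_flat hU hp hUp'
    (systemEnd F) (coordData p Γ C φ) hT
    (fun x hx a b ↦ hΓ.systemEnd_flat hU hUp hUp' h hφ ht hC hs hR hcod hx a b)
    ((0, 1) : (F →L[ℝ] ℝ) × ℝ)
  set μ : M → F →L[ℝ] ℝ := fun x ↦ (g x).1
  set f : M → ℝ := fun x ↦ (g x).2
  have hμs : ContMDiffOn I 𝓘(ℝ, F →L[ℝ] ℝ) ∞ μ W :=
    (ContinuousLinearMap.fst ℝ (F →L[ℝ] ℝ) ℝ).contMDiff.comp_contMDiffOn hgs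
  have hfs : ContMDiffOn I 𝓘(ℝ, ℝ) ∞ f W :=
    (ContinuousLinearMap.snd ℝ (F →L[ℝ] ℝ) ℝ).contMDiff.comp_contMDiffOn hgs
  have hμ : ∀ x ∈ W, ∀ v : TangentSpace I x, ∀ w, mvfderiv I μ x v w =
      μ x (Γ x v (constSection F V p w x)) - f x * C x v (constSection F V p w x) := by
    intro x hx v w
    rw [← mvfderiv_fst_eq (mdifferentiableAt_of_contMDiffOn hW hgs hx), hg x hx, systemEnd_fst]
    rfl
  have hf : ∀ x ∈ W, ∀ v : TangentSpace I x, mvfderiv I f x v = μ x (coord F V p x (φ x v)) := by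
    intro x hx v
    rw [← mvfderiv_snd_eq (mdifferentiableAt_of_contMDiffOn hW hgs hx), hg x hx, systemEnd_snd]
    rfl
  have hW' : IsOpen (W ∩ f ⁻¹' {0}ᶜ) :=
    hfs.continuousOn.isOpen_inter_preimage hW isOpen_compl_singleton
  have hfp : f p = 1 := by simp [f, hg1]
  have hsub : W ∩ f ⁻¹' {0}ᶜ ⊆ U := fun x hx ↦ hWU hx.1
  -- From `∇μ = -f C` and `df = μ ∘ φ`, the quotient satisfies `∇(-μ/f) = C + (μ ∘ φ) ⊗ μ / f²`, and
  -- the last term is `(ρ ∘ φ) ⊗ ρ`.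
  let ρ : Π x : M, V x →L[ℝ] ℝ := fun x ↦ (-(f x)⁻¹) • (μ x).comp (coord F V p x)
  have hρ : ∀ x (v : V x), ρ x v = -(f x)⁻¹ * μ x (coord F V p x v) := fun x v ↦ rfl
  have hρs : SmoothDualSectionOn I F (W ∩ f ⁻¹' {0}ᶜ) ρ := by
    refine smoothDualSectionOn_of_apply hW' fun W' hW'sub hW'o σ hσ ↦ ?_
    have h1 := (smoothOn_iff_coord hW'o ((hW'sub.trans hsub).trans hUp)).1 hσ
    have h2 := hfs.mono (hW'sub.trans Set.inter_subset_left)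
    have h3 := hμs.mono (hW'sub.trans Set.inter_subset_left)
    exact (h2.inv₀ fun x hx ↦ (hW'sub hx).2).neg.mul (h3.clm_apply h1)
  refine ⟨W ∩ f ⁻¹' {0}ᶜ, hW', ⟨hpW, by simp [hfp]⟩, hsub, ρ, hρs, ?_⟩
  intro W' hW'sub hW'o σ hσ x hx v
  have hxW := hW'sub hx
  have hf0 : f x ≠ 0 := hxW.2
  have h1 := mdifferentiableAt_of_contMDiffOn hW'o
    ((smoothOn_iff_coord hW'o ((hW'sub.trans hsub).trans hUp)).1 hσ) hx
  have h2 := mdifferentiableAt_of_contMDiffOn hW hμs hxW.1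
  have h3 := mdifferentiableAt_of_contMDiffOn hW hfs hxW.1
  have h4 := mdifferentiableAt_of_contMDiffOn hW'o ((hρs.mono hW'sub).apply hσ) hx
  -- Differentiating the product `f ρ(σ) = -μ(σ)` avoids the quotient rule; division by `f x`
  -- follows.
  have e : (fun y ↦ f y * ρ y (σ y)) =ᶠ[𝓝 x] fun y ↦ -μ y (coord F V p y (σ y)) := by
    filter_upwards [hW'o.mem_nhds hx] with y hy
    have : f y ≠ 0 := (hW'sub hy).2
    rw [hρ]
    field_simp
  have e1 := congr($(mvfderiv_congr (I := I) e) v)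
  rw [mvfderiv_fun_mul h3 h4, mvfderiv_fun_neg] at e1
  simp only [add_apply, smul_apply, neg_apply, smul_eq_mul] at e1
  rw [mvfderiv_clm_apply h2 h1, hμ x hxW.1, hf x hxW.1, constSection_coord (hUp (hsub hxW))] at e1
  have e2 := hΓ W' (hW'sub.trans hsub) hW'o σ hσ x hx v
  have e3 := congr(μ x $e2)
  rw [map_add] at e3
  have e4 : mvfderiv I (fun y ↦ ρ y (σ y)) x v = (f x)⁻¹ * (-(μ x (Γ x v (σ x)) - f x * C x v (σ x)
      + μ x (mvfderiv I (fun y ↦ coord F V p y (σ y)) x v))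
      - ρ x (σ x) * μ x (coord F V p x (φ x v))) := by
    rw [← e1]
    field_simp
    ring
  rw [e4, hρ, hρ, hρ, e3]
  field_simp
  ring

end Existence

end CoherentTangent

namespace CoherentTangent

/-! ### From a Codazzi tensor to projective flatness. -/

section Converse

set_option linter.unusedSectionVars false

variable {E : Type*} [NormedAddCommGroup E] [NormedSpace ℝ E] [FiniteDimensional ℝ E]
  {H : Type*} [TopologicalSpace H] {I : ModelWithCorners ℝ E H} [I.Boundaryless]
  {M : Type*} [TopologicalSpace M] [T2Space M] [ChartedSpace H M] [IsManifold I ∞ M]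
  {F : Type*} [NormedAddCommGroup F] [NormedSpace ℝ F] [FiniteDimensional ℝ F]
  {V : M → Type*} [TopologicalSpace (TotalSpace F V)] [∀ x, TopologicalSpace (V x)]
  [∀ x, AddCommGroup (V x)] [∀ x, Module ℝ (V x)]
  [∀ x, IsTopologicalAddGroup (V x)] [∀ x, ContinuousSMul ℝ (V x)]
  [FiberBundle F V] [VectorBundle ℝ F V] [ContMDiffVectorBundle ∞ F V I]
  {cov : (Π x : M, V x) → (Π x : M, TangentSpace I x →L[ℝ] V x)}
  {φ : Π x : M, TangentSpace I x →L[ℝ] V x}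

/-- A connection with trace-free curvature whose curvature is locally determined by a Codazzi tensor
is projectively flat. -/
theorem isProjectivelyFlat_of_codazziOn {n : ℕ}
    (hcov : IsCoherentTangentBundle I F φ cov) (htr : IsTraceFree hcov.connection)
    (hA : ∀ p : M, ∃ U : Set M, IsOpen U ∧ p ∈ U ∧
      ∃ A : Π x : M, TangentSpace I x →L[ℝ] V x →L[ℝ] ℝ, SmoothTensorOn I F U A ∧
        CurvatureFormulaOn I F n U φ cov A ∧ CodazziOn I F U cov A) :
    IsProjectivelyFlat I F φ cov := by
  intro p
  obtain ⟨U₀, hU₀, hp₀, A, hAs₀, hAR₀, hAC₀⟩ := hA p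
  -- Shrinking to the domains of both trivializations makes the constant frames of `V` and of the
  -- tangent bundle available.
  set U := U₀ ∩ ((trivializationAt F V p).baseSet
    ∩ (trivializationAt E (TangentSpace I) p).baseSet) with hUdef
  have hU : IsOpen U := hU₀.inter ((trivializationAt F V p).open_baseSet.inter
    (trivializationAt E (TangentSpace I) p).open_baseSet)
  have hp : p ∈ U := ⟨hp₀, FiberBundle.mem_baseSet_trivializationAt' p,
    FiberBundle.mem_baseSet_trivializationAt' p⟩
  have h := hcov.connection.mono (Set.subset_univ U)
  have hφ := hcov.smooth_map.mono (Set.subset_univ U)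
  have ht := hcov.torsionFree.mono hU (Set.subset_univ U) h hφ
  have hAs := hAs₀.mono (W := U) Set.inter_subset_left
  have hAR := hAR₀.mono hU Set.inter_subset_left h
  have hAC := hAC₀.mono hU Set.inter_subset_left h
  set C : Π x : M, TangentSpace I x →L[ℝ] V x →L[ℝ] ℝ := fun x ↦ (1 / ((n : ℝ) - 1)) • A x
  have hCs : SmoothTensorOn I F U C := smoothTensorOn_of_apply hU fun W hWU hW X σ hX hσ ↦
    contMDiffOn_const.mul ((hAs.mono hWU).apply hX hσ)
  have hR : ∀ (X Y : Π x : M, TangentSpace I x) (η : Π x : M, V x), SmoothOn I E U X →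
      SmoothOn I E U Y → SmoothOn I F U η → ∀ x ∈ U,
      curvature I cov X Y η x = C x (Y x) (η x) • φ x (X x) - C x (X x) (η x) • φ x (Y x) := by
    intro X Y η hX hY hη x hx
    rw [hAR X Y η hX hY hη x hx]
    simp only [C, smul_apply, smul_eq_mul, smul_sub, smul_smul]
  have hs : ∀ x ∈ U, ∀ v w : TangentSpace I x, C x v (φ x w) = C x w (φ x v) := by
    intro x hx v w
    obtain ⟨X, hX, rfl⟩ := exists_smoothOn_univ_eq (I := I) (F := E) v
    obtain ⟨Y, hY, rfl⟩ := exists_smoothOn_univ_eq (I := I) (F := E) w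
    -- There is no identity part here, so the trace is just `C(Y, φX) - C(X, φY)`.
    have := htr.eq_zero hX hY (x := x) (a := 0) (β := C x (Y x)) (γ := C x (X x)) (v := φ x (X x))
      (w := φ x (Y x)) fun η hη ↦ by
        rw [zero_smul, zero_add]
        exact hR X Y η (hX.mono (Set.subset_univ _)) (hY.mono (Set.subset_univ _))
          (hη.mono (Set.subset_univ _)) x hx
    linarith
  obtain ⟨W, hW, hpW, hWU, ρ, hρ, hB⟩ := exists_isSchoutenOn_of_codazziOn hU hp
    (fun x hx ↦ hx.2.1) (fun x hx ↦ hx.2.2) h hφ ht hCs hs hR (hAC.const_smul hU hAs _)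
  have h' := h.mono hWU
  have hφ' := hφ.mono hWU
  have ht' := ht.mono hW hWU h' hφ'
  refine ⟨W, hW, hpW, projectiveChange φ ρ cov, h'.projectiveChange hφ' hρ, ht'.projectiveChange,
    ?_, ρ, hρ, fun X η _ _ x _ ↦ projectiveChange_apply η x (X x)⟩
  intro X Y η hX hY hη x hx
  -- The curvature formula is known for arguments smooth on `U`, while these are smooth only on `W`;
  -- extensions with the same germs bridge the gap.
  obtain ⟨X', hX', eX⟩ := hX.exists_extension hW hx
  obtain ⟨Y', hY', eY⟩ := hY.exists_extension hW hx
  obtain ⟨η', hη', eη⟩ := hη.exists_extension hW hx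
  -- The multiple of `η` vanishes by symmetry of `C`, and the remaining correction is the negative
  -- of the original curvature.
  rw [hB.curvature_projectiveChange hW h' hφ' ht' hρ hX hY hη hx,
    ← curvature_eq_of_eventuallyEq hW h' (hX'.mono (Set.subset_univ _)) hX
      (hY'.mono (Set.subset_univ _)) hY (hη'.mono (Set.subset_univ _)) hη hx eX eY eη,
    hR X' Y' η' (hX'.mono (Set.subset_univ _)) (hY'.mono (Set.subset_univ _))
      (hη'.mono (Set.subset_univ _)) x (hWU hx), eX.self_of_nhds, eY.self_of_nhds,
    eη.self_of_nhds, hs x (hWU hx) (X x) (Y x)]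
  module

end Converse

end CoherentTangent

theorem mainTheorem5 {n : ℕ} (hn : n ≠ 1)
    {M : Type*} [TopologicalSpace M] [T2Space M] [ChartedSpace (EuclideanSpace ℝ (Fin n)) M]
    [IsManifold (𝓡 n) ∞ M]
    {F : Type*} [NormedAddCommGroup F] [NormedSpace ℝ F] [FiniteDimensional ℝ F]
    (hF : Module.finrank ℝ F = n)
    {V : M → Type*} [TopologicalSpace (TotalSpace F V)] [∀ x, TopologicalSpace (V x)]
    [∀ x, AddCommGroup (V x)] [∀ x, Module ℝ (V x)]
    [∀ x, IsTopologicalAddGroup (V x)] [∀ x, ContinuousSMul ℝ (V x)]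
    [FiberBundle F V] [VectorBundle ℝ F V] [ContMDiffVectorBundle ∞ F V (𝓡 n)]
    (φ : Π x : M, TangentSpace (𝓡 n) x →L[ℝ] V x)
    (cov : (Π x : M, V x) → (Π x : M, TangentSpace (𝓡 n) x →L[ℝ] V x))
    (hcov : CoherentTangent.IsCoherentTangentBundle (𝓡 n) F φ cov)
    (htrace : CoherentTangent.IsTraceFree hcov.connection) :
    CoherentTangent.IsProjectivelyFlat (𝓡 n) F φ cov ↔
      ∀ p : M, ∃ U : Set M, IsOpen U ∧ p ∈ U ∧
        ∃ A : Π x : M, TangentSpace (𝓡 n) x →L[ℝ] V x →L[ℝ] ℝ,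
          CoherentTangent.SmoothTensorOn (𝓡 n) F U A ∧
          CoherentTangent.CurvatureFormulaOn (𝓡 n) F n U φ cov A ∧
          CoherentTangent.CodazziOn (𝓡 n) F U cov A :=
  ⟨fun h p ↦ h.exists_codazziOn hn hcov htrace p,
    fun h ↦ CoherentTangent.isProjectivelyFlat_of_codazziOn hcov htrace h⟩
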